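/- **Setting.** Let $e$ be a strictly increasing, convex, continuous real function on an interval $I\subseteq\mathbb R$ which is $C^2$ with $e''>0$ in the interior of $I$, and let $\ell\colon e(I)\to I$ be its inverse. A real function $F$ on a convex set $S$ is called $\ell$-convex if $F=e\circ g$ for some convex function $g\colon S\to I$. If $F$ takes values in $[0,\infty]$, then $F$ is called $\ell$-convex if $S$ is convex, the set $\{F<\infty\}$ is convex and $F$ is $\ell$-convex on it (i.e. $F=e\circ g$ with $g\colon S\to I\cup\{\infty\}$ convex and $e(\infty)=\infty$). The function $\ell'/\ell''$ is considered in the interior of $e(I)$. It is called homogeneous if $e(I)$ is stable under multiplication by positive numbers and $(\ell'/\ell'')(st)=s\,(\ell'/\ell'')(t)$ for all $s>0$ and all $t$ in the interior of $e(I)$. Let $A$ be a C*-algebra and let $A_1,\dots,A_n$ be C*-subalgebras with $ab=ba$ for all $a\in A_i$, $b\in A_j$, $i\neq j$. For intervals $I_1,\dots,I_n$ let $(A_i)_{\mathrm{sa}}^{I_i}$ be the set of self-adjoint $x\in A_i$ with spectrum contained in $I_i$; spectra are taken in $A$ if $A$ is unital and in its unitization otherwise. For $\underline x=(x_1,\dots,x_n)$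 in $\bigoplus_i (A_i)_{\mathrm{sa}}^{I_i}$ and $f$ continuous on $I_1\times\dots\times I_n$, let $f(\underline x)$ be given by the joint continuous functional calculus: it is the element of the commutative unital C*-algebra generated by $x_1,\dots,x_n$ (and by the unit of $A$, or of its unitization) with $\chi(f(\underline x))=f(\chi(x_1),\dots,\chi(x_n))$ for all characters $\chi$ of that algebra. A trace is an additive, positively homogeneous map $\tau\colon A_+\to[0,\infty]$ with $\tau(x^*x)=\tau(xx^*)$ for all $x\in A$; it is densely defined if $\{\tau<\infty\}$ is dense in $A_+$. For a positive element $y$ of the unitization of a non-unital $A$ we put $\tau(y)=\sup\{\tau(a): a\in A,\ 0\le a\le y\}$, which agrees with the given value when $y\in A_+$. A tracial state on a unital $A$ is a positive linear functional $\tau$ with $\tau(\mathbf 1)=1$ and $\tau(x^*x)=\tau(xx^*)$ for all $x$. **Theorem 3 ($\ell$-Convex Trace Functions).** Let $f$ be a continuous function on a cube $I_1\times\dots\times I_n$ in $\mathbb R^n$, where the $I_i$ are intervals. Assume that $f$ is $\ell$-convex relative to a pair $e,\ell$ as above, and that $\ell'/\ell''$ is convex. If $A_1,\dots,A_n$ are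 mutually commuting C*-subalgebras of a unital C*-algebra $A$ and $\tau$ is a tracial state on $A$, then the function $$(x_1,\dots,x_n)\longmapsto\tau(f(x_1,\dots,x_n))$$ is $\ell$-convex on $\bigoplus_i (A_i)_{\mathrm{sa}}^{I_i}$. If moreover $\ell'/\ell''$ is homogeneous and $f\ge 0$, then for every C*-algebra $A$, unital or not, with mutually commuting C*-subalgebras $A_1,\dots,A_n$ and every densely defined, lower semicontinuous trace $\tau$ on $A$ (with $\tau\neq0$ in case $0\notin e(I)$), the $[0,\infty]$-valued function $(x_1,\dots,x_n)\mapsto\tau(f(x_1,\dots,x_n))$ is $\ell$-convex on $\bigoplus_i (A_i)_{\mathrm{sa}}^{I_i}$. -/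

import Mathlib

open Set
open scoped ENNReal NNReal ComplexOrder

/-! ### The pair `e`, `ℓ` and `ℓ`-convexity -/

/-- `e` is a strictly increasing, convex, continuous function on the interval `I`, which is `C²`
with positive second derivative in the interior of `I`, and `ℓ`, defined on `e(I)`, is the inverse
function of `e`. (`ConvexOn ℝ I e` contains the convexity of `I`.) -/
structure IsEllPair (e l : ℝ → ℝ) (I : Set ℝ) : Prop where
  strictMono : StrictMonoOn e I
  convex : ConvexOn ℝ I e
  continuous : ContinuousOn e I
  contDiff : ContDiffOn ℝ 2 e (interior I)
  deriv2_pos : ∀ s ∈ interior I, 0 < deriv (deriv e) s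
  leftInv : LeftInvOn l e I

/-- The function `ℓ' / ℓ''`. It is only used in the interior of `e(I)`. -/
noncomputable def ellQuot (l : ℝ → ℝ) (t : ℝ) : ℝ := deriv l t / deriv (deriv l) t

/-- `ℓ' / ℓ''` is homogeneous: the domain `J` of `ℓ` is stable under multiplication with positive
numbers, and `(ℓ'/ℓ'')(s t) = s (ℓ'/ℓ'')(t)` for `s > 0`. -/
def HomogeneousEllQuot (l : ℝ → ℝ) (J : Set ℝ) : Prop :=
  (∀ s > 0, ∀ t ∈ J, s * t ∈ J) ∧
    ∀ s > 0, ∀ t ∈ interior J, ellQuot l (s * t) = s * ellQuot l t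

/-- A real function `F` on a convex set `S` is `ℓ`-convex, where `ℓ` is the inverse of
`e : I → ℝ`, if `F = e ∘ g` for a convex function `g : S → I`. -/
def EllConvexOn {E : Type*} [AddCommGroup E] [Module ℝ E] (e : ℝ → ℝ) (I : Set ℝ) (S : Set E)
    (F : E → ℝ) : Prop :=
  ∃ g : E → ℝ, ConvexOn ℝ S g ∧ MapsTo g S I ∧ EqOn F (e ∘ g) S

/-- The same notion for functions with values in `[0, ∞]`: `F = e ∘ g` for a convex function
`g : S → I ∪ {∞}`, where `e(∞) = ∞`. -/
def ExtEllConvexOn {E : Type*} [AddCommGroup E] [Module ℝ E] (e : ℝ → ℝ) (I : Set ℝ) (S : Set E)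
    (F : E → ℝ≥0∞) : Prop :=
  Convex ℝ S ∧ EllConvexOn e I {x ∈ S | F x ≠ ∞} (fun x => (F x).toReal)

/-! ### Functions of several commuting self-adjoint elements -/

section JointCalculus

variable {A : Type*} [CStarAlgebra A] {n : ℕ}

/-- The unital C⋆-subalgebra generated by `x₁, …, xₙ`. -/
noncomputable def jointAlgebra (x : Fin n → A) : StarSubalgebra ℂ A :=
  (StarAlgebra.adjoin ℂ (range x)).topologicalClosure

lemma mem_jointAlgebra (x : Fin n → A) (i : Fin n) : x i ∈ jointAlgebra x :=
  StarSubalgebra.le_topologicalClosure _ (StarAlgebra.subset_adjoin ℂ _ (mem_range_self i))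

/-- `y = f(x₁, …, xₙ)`: the element `y` of the C⋆-algebra generated by `x₁, …, xₙ` satisfies
`χ(y) = f(χ(x₁), …, χ(xₙ))` for all characters `χ` of that algebra. -/
def IsJointCfc (f : (Fin n → ℝ) → ℝ) (x : Fin n → A) (y : A) : Prop :=
  ∃ hy : y ∈ jointAlgebra x, ∀ χ : jointAlgebra x →⋆ₐ[ℂ] ℂ,
    χ ⟨y, hy⟩ = ((f fun i => (χ ⟨x i, mem_jointAlgebra x i⟩).re : ℝ) : ℂ)

open Classical in
/-- The element `f(x₁, …, xₙ)` for commuting self-adjoint elements `x₁, …, xₙ` and a function `f`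
that is continuous on a product of sets containing the spectra of the `xᵢ`; see
`existsUnique_isJointCfc` and `isJointCfc_jointCfc`. -/
noncomputable def jointCfc (f : (Fin n → ℝ) → ℝ) (x : Fin n → A) : A :=
  if h : ∃ y, IsJointCfc f x y then h.choose else 0

/-- A function on the character space of a commutative unital C⋆-algebra is the Gelfand transform of
a unique element. -/
lemma existsUnique_of_characters {C : Type*} [CommCStarAlgebra C] {f : (Fin n → ℝ) → ℝ}
    {x : Fin n → C} {K : Set (Fin n → ℝ)} (hf : ContinuousOn f K)
    (hK : ∀ χ : C →⋆ₐ[ℂ] ℂ, (fun i => (χ (x i)).re) ∈ K) :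
    ∃! y : C, ∀ χ : C →⋆ₐ[ℂ] ℂ, χ y = ((f fun i => (χ (x i)).re : ℝ) : ℂ) := by
  have toHom : ∀ φ : WeakDual.characterSpace ℂ C, ∃ χ : C →⋆ₐ[ℂ] ℂ, ∀ a, χ a = φ a := fun φ =>
    ⟨{ WeakDual.CharacterSpace.equivAlgHom φ with map_star' := fun a => map_star φ a },
      fun _ => rfl⟩
  have hcont : Continuous (fun φ : WeakDual.characterSpace ℂ C =>
      ((f fun i => (φ (x i)).re : ℝ) : ℂ)) := by
    refine Complex.continuous_ofReal.comp (hf.comp_continuous ?_ ?_)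
    · refine continuous_pi fun i => Complex.continuous_re.comp ?_
      exact (map_continuous (WeakDual.gelfandTransform ℂ C (x i)))
    · intro φ
      obtain ⟨χ, hχ⟩ := toHom φ
      simpa [hχ] using hK χ
  refine ⟨(gelfandStarTransform C).symm ⟨_, hcont⟩, ?_, ?_⟩
  · intro χ
    have h : gelfandStarTransform C ((gelfandStarTransform C).symm ⟨_, hcont⟩) = ⟨_, hcont⟩ :=
      (gelfandStarTransform C).apply_symm_apply _
    have h2 := DFunLike.congr_fun h (WeakDual.CharacterSpace.equivAlgHom.symm χ.toAlgHom)
    exact h2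
  · intro y hy
    rw [StarAlgEquiv.eq_symm_apply]
    ext φ
    obtain ⟨χ, hχ⟩ := toHom φ
    have := hy χ
    simp only [hχ] at this
    exact this

/-- For commuting self-adjoint `x₁, …, xₙ` with spectra in `K₁, …, Kₙ` and `f` continuous on
`K₁ × ⋯ × Kₙ` the element `f(x₁, …, xₙ)` exists and is unique. -/
theorem existsUnique_isJointCfc {f : (Fin n → ℝ) → ℝ} {x : Fin n → A} {K : Fin n → Set ℝ}
    (hf : ContinuousOn f (univ.pi K)) (hx : ∀ i, IsSelfAdjoint (x i))
    (hc : ∀ i j, Commute (x i) (x j)) (hK : ∀ i, spectrum ℝ (x i) ⊆ K i) :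
    ∃! y, IsJointCfc f x y := by
  have hcomm : ∀ a ∈ range x, ∀ b ∈ range x, a * b = b * a := by
    rintro _ ⟨i, rfl⟩ _ ⟨j, rfl⟩; exact hc i j
  have hcomm' : ∀ a ∈ range x, ∀ b ∈ range x, a * star b = star b * a := by
    rintro _ ⟨i, rfl⟩ _ ⟨j, rfl⟩; rw [(hx j).star_eq]; exact hc i j
  have : IsMulCommutative (StarAlgebra.adjoin ℂ (range x)) :=
    StarAlgebra.isMulCommutative_adjoin ℂ hcomm hcomm'
  have hcl : IsClosed (jointAlgebra x : Set A) := StarSubalgebra.isClosed_topologicalClosure _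
  let iC : CommCStarAlgebra (jointAlgebra x) :=
    { (StarSubalgebra.cstarAlgebra (jointAlgebra x) (h_closed := hcl) :
        CStarAlgebra (jointAlgebra x)) with
      mul_comm := (StarSubalgebra.commRingTopologicalClosure (StarAlgebra.adjoin ℂ (range x))
        (fun a b => mul_comm' a b)).mul_comm }
  have key := existsUnique_of_characters (C := jointAlgebra x) (f := f)
    (x := fun i => ⟨x i, mem_jointAlgebra x i⟩) hf (by
      intro χ i _
      refine hK i ((spectrum.algebraMap_mem_iff ℂ).1 ?_)
      have h1 : χ ⟨x i, mem_jointAlgebra x i⟩ ∈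
          spectrum ℂ (⟨x i, mem_jointAlgebra x i⟩ : jointAlgebra x) :=
        AlgHom.apply_mem_spectrum χ _
      rw [StarSubalgebra.spectrum_eq (hS := hcl)] at h1
      have h2 := (hx i).mem_spectrum_eq_re h1
      change ((χ ⟨x i, mem_jointAlgebra x i⟩).re : ℂ) ∈ _
      rw [← h2]
      exact h1)
  obtain ⟨y, hy, huniq⟩ := key
  refine ⟨y, ⟨y.2, hy⟩, ?_⟩
  rintro z ⟨hz, hz'⟩
  exact congrArg Subtype.val (huniq ⟨z, hz⟩ hz')

theorem isJointCfc_jointCfc {f : (Fin n → ℝ) → ℝ} {x : Fin n → A} {K : Fin n → Set ℝ}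
    (hf : ContinuousOn f (univ.pi K)) (hx : ∀ i, IsSelfAdjoint (x i))
    (hc : ∀ i j, Commute (x i) (x j)) (hK : ∀ i, spectrum ℝ (x i) ⊆ K i) :
    IsJointCfc f x (jointCfc f x) := by
  have h := (existsUnique_isJointCfc hf hx hc hK).exists
  rw [jointCfc, dif_pos h]
  exact h.choose_spec

end JointCalculus

/-! ### Traces and domains -/

/-- The C⋆-subalgebras `A₁, …, Aₙ` are mutually commuting. -/
def MutuallyCommuting {A : Type*} [NonUnitalCStarAlgebra A] {n : ℕ}
    (B : Fin n → NonUnitalStarSubalgebra ℂ A) : Prop :=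
  ∀ i j, i ≠ j → ∀ a ∈ B i, ∀ b ∈ B j, Commute a b

/-- A tracial state on a unital C⋆-algebra. -/
structure IsTracialState {A : Type*} [CStarAlgebra A] [PartialOrder A] [StarOrderedRing A]
    (τ : A →ₗ[ℂ] ℂ) : Prop where
  nonneg : ∀ a, 0 ≤ a → 0 ≤ τ a
  map_one : τ 1 = 1
  tracial : ∀ a, τ (star a * a) = τ (a * star a)

/-- A densely defined, lower semicontinuous trace `τ : A₊ → [0, ∞]`. The values of the function `τ`
outside `A₊` are irrelevant. -/
structure IsDenseLscTrace {A : Type*} [NonUnitalCStarAlgebra A] [PartialOrder A]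
    [StarOrderedRing A] (τ : A → ℝ≥0∞) : Prop where
  map_zero : τ 0 = 0
  map_add : ∀ a b, 0 ≤ a → 0 ≤ b → τ (a + b) = τ a + τ b
  map_smul : ∀ (r : ℝ≥0) (a : A), 0 ≤ a → τ ((r : ℝ) • a) = r * τ a
  tracial : ∀ a, τ (star a * a) = τ (a * star a)
  lsc : LowerSemicontinuousOn τ {a | 0 ≤ a}
  dense : {a : A | 0 ≤ a} ⊆ closure {a | 0 ≤ a ∧ τ a < ∞}

/-- The canonical extension of a trace on `A` to the positive elements `y` of the unitization of
`A`, `τ(y) = sup {τ(a) | a ∈ A, 0 ≤ a ≤ y}`; see `traceExt_inr`. -/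
noncomputable def traceExt {A : Type*} [NonUnitalCStarAlgebra A] [PartialOrder A]
    [StarOrderedRing A] (τ : A → ℝ≥0∞) (y : Unitization ℂ A) : ℝ≥0∞ :=
  ⨆ (a : A) (_ : 0 ≤ a) (_ : (a : Unitization ℂ A) ≤ y), τ a

/-- The extension agrees with `τ` on `A₊`. -/
theorem traceExt_inr {A : Type*} [NonUnitalCStarAlgebra A] [PartialOrder A] [StarOrderedRing A]
    {τ : A → ℝ≥0∞} (hτ : IsDenseLscTrace τ) {b : A} (hb : 0 ≤ b) :
    traceExt τ (b : Unitization ℂ A) = τ b := by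
  refine le_antisymm ?_ (le_iSup_of_le b (le_iSup_of_le hb (le_iSup_of_le le_rfl le_rfl)))
  refine iSup_le fun a => iSup_le fun ha => iSup_le fun hab => ?_
  have h : a ≤ b := (Unitization.inr_le_iff a b (.of_nonneg ha) (.of_nonneg hb)).1 hab
  have h2 := hτ.map_add a (b - a) ha (sub_nonneg.2 h)
  rw [add_sub_cancel] at h2
  rw [h2]
  exact le_self_add

/-- The set of tuples `(x₁, …, xₙ)` of self-adjoint elements `xᵢ ∈ Aᵢ` whose spectra in the unital
C⋆-algebra `A` are contained in `Kᵢ`. -/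
def saTuples {A : Type*} [CStarAlgebra A] {n : ℕ} (B : Fin n → NonUnitalStarSubalgebra ℂ A)
    (K : Fin n → Set ℝ) : Set (Fin n → A) :=
  {x | ∀ i, x i ∈ B i ∧ IsSelfAdjoint (x i) ∧ spectrum ℝ (x i) ⊆ K i}

/-- The same set if `A` need not be unital; spectra are now taken in the unitization of `A`
(`quasispectrum` is that spectrum). -/
def saTuplesNonUnital {A : Type*} [NonUnitalCStarAlgebra A] {n : ℕ}
    (B : Fin n → NonUnitalStarSubalgebra ℂ A) (K : Fin n → Set ℝ) : Set (Fin n → A) :=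
  {x | ∀ i, x i ∈ B i ∧ IsSelfAdjoint (x i) ∧ quasispectrum ℝ (x i) ⊆ K i}

/-! Write `g = ℓ ∘ f`, so that `f = e ∘ g` with `g` convex, and let `z = a x + b y`. The claim is
the inequality `ω(f(z)) ≤ e(a ℓ(ω(f(x))) + b ℓ(ω(f(y))))` for a trace `ω`.

The scalar core is that `u ↦ ℓ(∑ wₖ e(uₖ))` is convex (`IsEllPair.mean_le`). Since `ℓ'/ℓ''` at
`e(s)` equals `-e'(s)²/e''(s)`, its convexity is concavity of `e'²/e''` in the variable `e(s)`;
combined with Cauchy–Schwarz, this makes the second derivative of the mean nonnegative. Weights of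
total mass 1 need nothing more; other total masses use homogeneity.

The passage to operators is `apply_jointCfc_le`. Although `x` and `y` need not commute with each
other, the components of `z` commute. A fine partition of unity on the joint spectrum of `z` gives
self-adjoint `dₖ` with `∑ dₖ² = 1`. For each `k`, the functional `ω(dₖ · dₖ)` has barycenters `uₖ`
with respect to `x` and `vₖ` with respect to `y`. Then `a uₖ + b vₖ` is a barycenter for `z`, and
`f(z)` is nearly `f(a uₖ + b vₖ)` on the `k`-th piece. Jensen's inequality gives `wₖ f(uₖ) ≤ ω(dₖ
f(x) dₖ)`, likewise for `y`, and the scalar inequality finishes. The trace property enters only as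
the bound of `∑ ω(dₖ f(x) dₖ)` by the trace of `f(x)`.

For an unbounded trace, the same inequality is applied to the bounded functionals `τ(v* · v)` on the
unitization. They need not be tracial, but they satisfy the required bound against the extended
trace (`exists_isDominated_compress`), and by lower semicontinuity their supremum recovers it
(`exists_isDominated_traceExt`). -/

open Filter Topology

universe u

/-! ### Calculus of the pair `e`, `ℓ`. -/

namespace IsEllPair

variable {e l : ℝ → ℝ} {I : Set ℝ}

lemma ordConnected (h : IsEllPair e l I) : I.OrdConnected := h.convex.1.ordConnected

lemma ordConnected_image (h : IsEllPair e l I) : (e '' I).OrdConnected :=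
  ((h.convex.1.isPreconnected).image e h.continuous).ordConnected

lemma interior_image (h : IsEllPair e l I) : interior (e '' I) = e '' interior I := by
  have hI := h.ordConnected
  apply Subset.antisymm
  · intro t ht
    obtain ⟨s, hs, rfl⟩ := interior_subset ht
    refine ⟨s, ?_, rfl⟩
    obtain ⟨a, b, hab, hsub⟩ := mem_nhds_iff_exists_Ioo_subset.1 (mem_interior_iff_mem_nhds.1 ht)
    obtain ⟨c, hc⟩ := exists_between hab.1
    obtain ⟨d, hd⟩ := exists_between hab.2
    obtain ⟨s₁, hs₁, rfl⟩ := hsub ⟨hc.1, hc.2.trans hab.2⟩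
    obtain ⟨s₂, hs₂, rfl⟩ := hsub ⟨hab.1.trans hd.1, hd.2⟩
    have h1 := (h.strictMono.lt_iff_lt hs₁ hs).1 hc.2
    have h2 := (h.strictMono.lt_iff_lt hs hs₂).1 hd.1
    exact mem_interior_iff_mem_nhds.2
      (mem_of_superset (Icc_mem_nhds h1 h2) (hI.out hs₁ hs₂))
  · rintro _ ⟨s, hs, rfl⟩
    obtain ⟨a, b, hab, hsub⟩ := mem_nhds_iff_exists_Ioo_subset.1 (mem_interior_iff_mem_nhds.1 hs)
    obtain ⟨c, hc⟩ := exists_between hab.1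
    obtain ⟨d, hd⟩ := exists_between hab.2
    have hcI := hsub ⟨hc.1, hc.2.trans hab.2⟩
    have hdI := hsub ⟨hab.1.trans hd.1, hd.2⟩
    have hsI := interior_subset hs
    refine mem_interior_iff_mem_nhds.2 (mem_of_superset
      (Icc_mem_nhds (h.strictMono hcI hsI hc.2) (h.strictMono hsI hdI hd.1)) ?_)
    exact h.ordConnected_image.out (mem_image_of_mem _ hcI) (mem_image_of_mem _ hdI)

lemma hasStrictDerivAt (h : IsEllPair e l I) {s : ℝ} (hs : s ∈ interior I) :
    HasStrictDerivAt e (deriv e s) s :=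
  (h.contDiff.contDiffAt (isOpen_interior.mem_nhds hs)).hasStrictDerivAt (by norm_num)

lemma hasDerivAt_deriv (h : IsEllPair e l I) {s : ℝ} (hs : s ∈ interior I) :
    HasDerivAt (deriv e) (deriv (deriv e) s) s := by
  have h1 : ContDiffOn ℝ 1 (deriv e) (interior I) :=
    h.contDiff.deriv_of_isOpen isOpen_interior (by norm_num)
  exact ((h1.contDiffAt (isOpen_interior.mem_nhds hs)).differentiableAt (by norm_num)).hasDerivAt

/-- Monotonicity gives only `e' ≥ 0`; as `e'` is strictly increasing, comparison with a point to the
left makes it positive. -/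
lemma deriv_pos (h : IsEllPair e l I) {s : ℝ} (hs : s ∈ interior I) : 0 < deriv e s := by
  have hnonneg : ∀ r ∈ interior I, 0 ≤ deriv e r := fun r hr => by
    have hmono : MonotoneOn e (interior I) := h.strictMono.monotoneOn.mono interior_subset
    rw [← derivWithin_of_isOpen isOpen_interior hr]
    exact hmono.derivWithin_nonneg
  have hconv : Convex ℝ (interior I) := h.convex.1.interior
  have hstrict : StrictMonoOn (deriv e) (interior I) := by
    refine strictMonoOn_of_deriv_pos hconv
      (fun r hr => (h.hasDerivAt_deriv hr).continuousAt.continuousWithinAt) fun r hr => ?_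
    exact h.deriv2_pos r (interior_subset hr)
  obtain ⟨a, b, hab, hsub⟩ := mem_nhds_iff_exists_Ioo_subset.1 (isOpen_interior.mem_nhds hs)
  obtain ⟨c, hc⟩ := exists_between hab.1
  have hcI := hsub ⟨hc.1, hc.2.trans hab.2⟩
  exact (hnonneg c hcI).trans_lt (hstrict hcI hs hc.2)

lemma hasDerivAt_inv (h : IsEllPair e l I) {s : ℝ} (hs : s ∈ interior I) :
    HasDerivAt l (deriv e s)⁻¹ (e s) := by
  refine ((h.hasStrictDerivAt hs).to_local_left_inverse (h.deriv_pos hs).ne' ?_).hasDerivAt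
  filter_upwards [isOpen_interior.mem_nhds hs] with r hr
  exact h.leftInv (interior_subset hr)

/-- From `ℓ' = 1/(e' ∘ ℓ)` one gets `ℓ'' = -e''/e'³` at `ℓ`. The minus sign turns convexity of
`ℓ'/ℓ''` into concavity of `e'²/e''`. -/
lemma ellQuot_apply (h : IsEllPair e l I) {s : ℝ} (hs : s ∈ interior I) :
    ellQuot l (e s) = -(deriv e s ^ 2 / deriv (deriv e) s) := by
  have hpos := h.deriv_pos hs
  have h2pos := h.deriv2_pos s hs
  have hls : l (e s) = s := h.leftInv (interior_subset hs)
  have hev : deriv l =ᶠ[𝓝 (e s)] fun t => (deriv e (l t))⁻¹ := by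
    have : interior (e '' I) ∈ 𝓝 (e s) :=
      isOpen_interior.mem_nhds (h.interior_image ▸ mem_image_of_mem e hs)
    filter_upwards [this] with t ht
    rw [h.interior_image] at ht
    obtain ⟨r, hr, rfl⟩ := ht
    rw [(h.hasDerivAt_inv hr).deriv, h.leftInv (interior_subset hr)]
  have h1 : HasDerivAt (fun t => deriv e (l t)) (deriv (deriv e) s * (deriv e s)⁻¹) (e s) := by
    have := h.hasDerivAt_deriv hs
    rw [← hls] at this
    have h3 := HasDerivAt.comp (e s) this (h.hasDerivAt_inv hs)
    rw [hls] at h3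
    exact h3
  have h2 := (h1.fun_inv (by rw [hls]; exact hpos.ne')).deriv
  rw [ellQuot, hev.deriv_eq, h2, (h.hasDerivAt_inv hs).deriv, hls]
  field_simp

lemma continuousOn_inv (h : IsEllPair e l I) : ContinuousOn l (e '' I) := by
  have := h.ordConnected
  have := h.ordConnected_image
  rw [continuousOn_iff_continuous_domRestrict]
  have h1 : (e '' I).domRestrict l = fun t => ((h.strictMono.orderIso e I).symm t : ℝ) := by
    ext t
    obtain ⟨s, rfl⟩ := (h.strictMono.orderIso e I).surjective t
    rw [OrderIso.symm_apply_apply]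
    exact h.leftInv s.2
  rw [h1]
  exact continuous_subtype_val.comp (h.strictMono.orderIso e I).symm.continuous

lemma mapsTo_inv (h : IsEllPair e l I) : MapsTo l (e '' I) I := by
  rintro _ ⟨s, hs, rfl⟩
  rwa [h.leftInv hs]

lemma apply_inv (h : IsEllPair e l I) {t : ℝ} (ht : t ∈ e '' I) : e (l t) = t := by
  obtain ⟨s, hs, rfl⟩ := ht
  rw [h.leftInv hs]

lemma monotoneOn_inv (h : IsEllPair e l I) : MonotoneOn l (e '' I) := by
  rintro _ ⟨s, hs, rfl⟩ _ ⟨r, hr, rfl⟩ hsr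
  rw [h.leftInv hs, h.leftInv hr]
  exact (h.strictMono.le_iff_le hs hr).1 hsr

end IsEllPair

/-! ### Total masses of weights: `W = 1` for states, all `W > 0` under homogeneity. -/

/-- The positive number `W` scales the domain `J` of `l`, and `l' / l''` is homogeneous with respect
to `W`. -/
structure EllScale (l : ℝ → ℝ) (J : Set ℝ) (W : ℝ) : Prop where
  pos : 0 < W
  mul_mem : ∀ t ∈ J, W * t ∈ J
  ellQuot_mul : ∀ t ∈ interior J, ellQuot l (W * t) = W * ellQuot l t

lemma EllScale.one (l : ℝ → ℝ) (J : Set ℝ) : EllScale l J 1 :=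
  ⟨one_pos, by simp, by simp⟩

lemma HomogeneousEllQuot.ellScale {l : ℝ → ℝ} {J : Set ℝ} (h : HomogeneousEllQuot l J) {W : ℝ}
    (hW : 0 < W) : EllScale l J W :=
  ⟨hW, h.1 W hW, h.2 W hW⟩

lemma EllScale.mul_mem_interior {l : ℝ → ℝ} {J : Set ℝ} {W : ℝ} (h : EllScale l J W) {t : ℝ}
    (ht : t ∈ interior J) : W * t ∈ interior J := by
  have hopen : IsOpen ((fun t => W * t) '' interior J) :=
    (Homeomorph.mulLeft₀ W h.pos.ne').isOpenMap _ isOpen_interior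
  refine interior_maximal ?_ hopen (mem_image_of_mem _ ht)
  rintro _ ⟨s, hs, rfl⟩
  exact h.mul_mem s (interior_subset hs)

/-! ### Convexity of weighted quasi-arithmetic means. -/

section Mean

variable {e l : ℝ → ℝ} {I : Set ℝ} {ι : Type*} {s : Finset ι} {w : ι → ℝ}

lemma sum_eq_mul_sum_div (hW : 0 < ∑ k ∈ s, w k) (b : ι → ℝ) :
    ∑ k ∈ s, w k * b k = (∑ k ∈ s, w k) * ∑ k ∈ s, (w k / ∑ k ∈ s, w k) • b k := by
  rw [Finset.mul_sum]
  refine Finset.sum_congr rfl fun k _ => ?_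
  rw [smul_eq_mul]
  field_simp

lemma EllScale.sum_mem {J : Set ℝ} (hJ : J.OrdConnected) (hw : ∀ k ∈ s, 0 ≤ w k)
    (hW : EllScale l J (∑ k ∈ s, w k)) {b : ι → ℝ} (hb : ∀ k ∈ s, b k ∈ J) :
    ∑ k ∈ s, w k * b k ∈ J := by
  rw [sum_eq_mul_sum_div hW.pos]
  refine hW.mul_mem _ (hJ.convex.sum_mem (fun k hk => div_nonneg (hw k hk) hW.pos.le) ?_ hb)
  rw [← Finset.sum_div, div_self hW.pos.ne']

lemma EllScale.sum_mem_interior {J : Set ℝ} (hJ : J.OrdConnected) (hw : ∀ k ∈ s, 0 ≤ w k)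
    (hW : EllScale l J (∑ k ∈ s, w k)) {b : ι → ℝ} (hb : ∀ k ∈ s, b k ∈ interior J) :
    ∑ k ∈ s, w k * b k ∈ interior J := by
  rw [sum_eq_mul_sum_div hW.pos]
  refine hW.mul_mem_interior
    (hJ.convex.interior.sum_mem (fun k hk => div_nonneg (hw k hk) hW.pos.le) ?_ hb)
  rw [← Finset.sum_div, div_self hW.pos.ne']

/-- Jensen's inequality for the normalized weights; homogeneity restores the total mass. -/
lemma EllScale.ellQuot_sum_le {J : Set ℝ} (hl : ConvexOn ℝ (interior J) (ellQuot l))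
    (hw : ∀ k ∈ s, 0 ≤ w k) (hW : EllScale l J (∑ k ∈ s, w k)) {b : ι → ℝ}
    (hb : ∀ k ∈ s, b k ∈ interior J) :
    ellQuot l (∑ k ∈ s, w k * b k) ≤ ∑ k ∈ s, w k * ellQuot l (b k) := by
  have h0 : ∀ k ∈ s, 0 ≤ w k / ∑ k ∈ s, w k := fun k hk => div_nonneg (hw k hk) hW.pos.le
  have h1 : ∑ k ∈ s, w k / ∑ k ∈ s, w k = 1 := by rw [← Finset.sum_div, div_self hW.pos.ne']
  rw [sum_eq_mul_sum_div hW.pos, sum_eq_mul_sum_div hW.pos (fun k => ellQuot l (b k)),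
    hW.ellQuot_mul _ (hl.1.sum_mem h0 h1 hb)]
  exact mul_le_mul_of_nonneg_left (hl.map_sum_le h0 h1 hb) hW.pos.le

/-- Convexity of the quasi-arithmetic mean `l (∑ w e(u))` along segments in the interior. -/
lemma IsEllPair.convexOn_mean (h : IsEllPair e l I)
    (hl : ConvexOn ℝ (interior (e '' I)) (ellQuot l)) (hw : ∀ k ∈ s, 0 ≤ w k)
    (hW : EllScale l (e '' I) (∑ k ∈ s, w k)) {u v : ι → ℝ} (hu : ∀ k ∈ s, u k ∈ interior I)
    (hv : ∀ k ∈ s, v k ∈ interior I) :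
    ConvexOn ℝ (Icc 0 1) fun t : ℝ => l (∑ k ∈ s, w k * e (u k + t * (v k - u k))) := by
  set p : ι → ℝ → ℝ := fun k t => u k + t * (v k - u k) with hp
  set E : ℝ → ℝ := fun t => ∑ k ∈ s, w k * e (p k t) with hE
  have hpI : ∀ t ∈ Icc (0 : ℝ) 1, ∀ k ∈ s, p k t ∈ interior I := fun t ht k hk => by
    have := h.convex.1.interior (hu k hk) (hv k hk) (sub_nonneg.2 ht.2) ht.1 (by ring)
    convert this using 1
    simp only [hp, smul_eq_mul]; ring
  have hEI : ∀ t ∈ Icc (0 : ℝ) 1, ∃ m ∈ interior I, e m = E t := fun t ht => by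
    have := hW.sum_mem_interior h.ordConnected_image hw (b := fun k => e (p k t)) fun k hk => by
      rw [h.interior_image]; exact mem_image_of_mem e (hpI t ht k hk)
    rwa [h.interior_image] at this
  have hpd : ∀ k t, HasDerivAt (p k) (v k - u k) t := fun k t => by
    have := ((hasDerivAt_id t).mul_const (v k - u k)).const_add (u k)
    rwa [one_mul] at this
  have hEd : ∀ t ∈ Icc (0 : ℝ) 1,
      HasDerivAt E (∑ k ∈ s, w k * (deriv e (p k t) * (v k - u k))) t := fun t ht =>
    HasDerivAt.fun_sum fun k hk =>
      (((h.hasStrictDerivAt (hpI t ht k hk)).hasDerivAt).comp t (hpd k t)).const_mul (w k)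
  have hEd2 : ∀ t ∈ Icc (0 : ℝ) 1,
      HasDerivAt (fun t => ∑ k ∈ s, w k * (deriv e (p k t) * (v k - u k)))
        (∑ k ∈ s, w k * (deriv (deriv e) (p k t) * (v k - u k) * (v k - u k))) t := fun t ht =>
    HasDerivAt.fun_sum fun k hk =>
      (((h.hasDerivAt_deriv (hpI t ht k hk)).comp t (hpd k t)).mul_const _).const_mul (w k)
  set E₁ : ℝ → ℝ := fun t => ∑ k ∈ s, w k * (deriv e (p k t) * (v k - u k))
  set E₂ : ℝ → ℝ := fun t => ∑ k ∈ s, w k * (deriv (deriv e) (p k t) * (v k - u k) * (v k - u k))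
  have hM : ∀ t ∈ Icc (0 : ℝ) 1, l (E t) ∈ interior I ∧ e (l (E t)) = E t := fun t ht => by
    obtain ⟨m, hm, hme⟩ := hEI t ht
    rw [← hme, h.leftInv (interior_subset hm)]
    exact ⟨hm, rfl⟩
  have hMd : ∀ t ∈ Icc (0 : ℝ) 1,
      HasDerivAt (fun t => l (E t)) ((deriv e (l (E t)))⁻¹ * E₁ t) t := fun t ht => by
    have h1 := h.hasDerivAt_inv (hM t ht).1
    rw [(hM t ht).2] at h1
    exact h1.comp t (hEd t ht)
  have hMd2 : ∀ t ∈ Icc (0 : ℝ) 1, HasDerivAt (fun t => (deriv e (l (E t)))⁻¹ * E₁ t)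
      (-(deriv (deriv e) (l (E t)) * ((deriv e (l (E t)))⁻¹ * E₁ t)) / deriv e (l (E t)) ^ 2 * E₁ t
        + (deriv e (l (E t)))⁻¹ * E₂ t) t := fun t ht => by
    have h1 : HasDerivAt (fun t => deriv e (l (E t)))
        (deriv (deriv e) (l (E t)) * ((deriv e (l (E t)))⁻¹ * E₁ t)) t :=
      HasDerivAt.comp (h₂ := deriv e) t (h.hasDerivAt_deriv (hM t ht).1) (hMd t ht)
    exact (h1.fun_inv (h.deriv_pos (hM t ht).1).ne').mul (hEd2 t ht)
  refine convexOn_of_hasDerivWithinAt2_nonneg (convex_Icc 0 1)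
    (fun t ht => (hMd t ht).continuousAt.continuousWithinAt)
    (fun t ht => (hMd t (interior_subset ht)).hasDerivWithinAt)
    (fun t ht => (hMd2 t (interior_subset ht)).hasDerivWithinAt) fun t ht => ?_
  replace ht := interior_subset ht
  -- With `M = ℓ(E)`, nonnegativity of `M''` means `E₁² e''(M) ≤ e'(M)² E₂`. This follows from two
  -- inequalities: concavity of `e'²/e''` in `e`, and Cauchy–Schwarz.
  have hq := hW.ellQuot_sum_le hl hw (b := fun k => e (p k t)) fun k hk => by
    rw [h.interior_image]; exact mem_image_of_mem e (hpI t ht k hk)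
  change ellQuot l (E t) ≤ _ at hq
  rw [← (hM t ht).2, h.ellQuot_apply (hM t ht).1] at hq
  have hq' : ∑ k ∈ s, w k * (deriv e (p k t) ^ 2 / deriv (deriv e) (p k t)) ≤
      deriv e (l (E t)) ^ 2 / deriv (deriv e) (l (E t)) := by
    rw [← neg_le_neg_iff, ← Finset.sum_neg_distrib]
    refine hq.trans_eq (Finset.sum_congr rfl fun k hk => ?_)
    rw [h.ellQuot_apply (hpI t ht k hk)]; ring
  -- Cauchy–Schwarz with each summand split as `e' (v - u) = (e'/√e'') · (√e'' (v - u))`.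
  have hcs : E₁ t ^ 2 ≤
      (∑ k ∈ s, w k * (deriv e (p k t) ^ 2 / deriv (deriv e) (p k t))) * E₂ t := by
    refine Finset.sum_sq_le_sum_mul_sum_of_sq_le_mul s (fun k hk => ?_) (fun k hk => ?_)
      fun k hk => ?_
    · exact mul_nonneg (hw k hk) (div_nonneg (sq_nonneg _) (h.deriv2_pos _ (hpI t ht k hk)).le)
    · rw [mul_assoc]
      exact mul_nonneg (hw k hk)
        (mul_nonneg (h.deriv2_pos _ (hpI t ht k hk)).le (mul_self_nonneg _))
    · have := (h.deriv2_pos _ (hpI t ht k hk)).ne'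
      refine le_of_eq ?_
      field_simp
  have hE₂ : 0 ≤ E₂ t := Finset.sum_nonneg fun k hk => by
    rw [mul_assoc]
    exact mul_nonneg (hw k hk)
      (mul_nonneg (h.deriv2_pos _ (hpI t ht k hk)).le (mul_self_nonneg _))
  have hfin := hcs.trans (mul_le_mul_of_nonneg_right hq' hE₂)
  have hd := h.deriv_pos (hM t ht).1
  have hd2 := h.deriv2_pos _ (hM t ht).1
  rw [div_mul_eq_mul_div, le_div_iff₀ hd2] at hfin
  have : -(deriv (deriv e) (l (E t)) * ((deriv e (l (E t)))⁻¹ * E₁ t)) / deriv e (l (E t)) ^ 2 *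
      E₁ t + (deriv e (l (E t)))⁻¹ * E₂ t =
      (deriv e (l (E t)) ^ 2 * E₂ t - E₁ t ^ 2 * deriv (deriv e) (l (E t))) /
        deriv e (l (E t)) ^ 3 := by
    field_simp
    ring
  rw [this]
  exact div_nonneg (sub_nonneg.2 hfin) (by positivity)

lemma IsEllPair.mean_le_of_mem_interior (h : IsEllPair e l I)
    (hl : ConvexOn ℝ (interior (e '' I)) (ellQuot l)) (hw : ∀ k ∈ s, 0 ≤ w k)
    (hW : EllScale l (e '' I) (∑ k ∈ s, w k)) {u v : ι → ℝ} (hu : ∀ k ∈ s, u k ∈ interior I)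
    (hv : ∀ k ∈ s, v k ∈ interior I) {a b : ℝ} (ha : 0 ≤ a) (hb : 0 ≤ b) (hab : a + b = 1) :
    l (∑ k ∈ s, w k * e (a * u k + b * v k)) ≤
      a * l (∑ k ∈ s, w k * e (u k)) + b * l (∑ k ∈ s, w k * e (v k)) := by
  have := (h.convexOn_mean hl hw hW hu hv).2 (left_mem_Icc.2 zero_le_one)
    (right_mem_Icc.2 zero_le_one) ha hb hab
  obtain rfl : a = 1 - b := by linarith
  simp only [smul_eq_mul, mul_zero, mul_one, zero_add, zero_mul, add_zero, one_mul,
    add_sub_cancel] at this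
  refine le_of_eq_of_le ?_ this
  congr! 4 with k
  ring

/-- The weighted mean `l (∑ w e(u))` is a convex function of `u`. -/
lemma IsEllPair.mean_le (h : IsEllPair e l I)
    (hl : ConvexOn ℝ (interior (e '' I)) (ellQuot l)) (hw : ∀ k ∈ s, 0 ≤ w k)
    (hW : EllScale l (e '' I) (∑ k ∈ s, w k)) {u v : ι → ℝ} (hu : ∀ k ∈ s, u k ∈ I)
    (hv : ∀ k ∈ s, v k ∈ I) {a b : ℝ} (ha : 0 ≤ a) (hb : 0 ≤ b) (hab : a + b = 1) :
    l (∑ k ∈ s, w k * e (a * u k + b * v k)) ≤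
      a * l (∑ k ∈ s, w k * e (u k)) + b * l (∑ k ∈ s, w k * e (v k)) := by
  rcases (interior I).eq_empty_or_nonempty with hI | ⟨c, hc⟩
  · have hsub : I.Subsingleton := by
      by_contra hns
      rw [not_subsingleton_iff] at hns
      obtain ⟨x, hx, y, hy, hxy⟩ := hns.exists_lt
      obtain ⟨m, hm⟩ := exists_between hxy
      have : m ∈ interior I := mem_interior_iff_mem_nhds.2
        (mem_of_superset (Icc_mem_nhds hm.1 hm.2) (h.ordConnected.out hx hy))
      rw [hI] at this
      exact this
    have h1 : ∑ k ∈ s, w k * e (a * u k + b * v k) = ∑ k ∈ s, w k * e (u k) :=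
      Finset.sum_congr rfl fun k hk => by
        have := hsub (h.convex.1 (hu k hk) (hv k hk) ha hb hab) (hu k hk)
        rw [smul_eq_mul, smul_eq_mul] at this
        rw [this]
    have h2 : ∑ k ∈ s, w k * e (v k) = ∑ k ∈ s, w k * e (u k) :=
      Finset.sum_congr rfl fun k hk => by rw [hsub (hv k hk) (hu k hk)]
    rw [h1, h2, ← add_mul, hab, one_mul]
  -- Endpoints of `I` are reached by a limit: moving all points towards the interior point `c` by
  -- the fraction `d` commutes with the combination `a u + b v`, because `a + b = 1`.
  · have key : ∀ r : ι → ℝ, (∀ k ∈ s, r k ∈ I) →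
        (∀ d ∈ Ioc (0 : ℝ) 1, ∀ k ∈ s, r k + d * (c - r k) ∈ interior I) ∧
        Tendsto (fun d : ℝ => l (∑ k ∈ s, w k * e (r k + d * (c - r k)))) (𝓝[Ioc 0 1] 0)
          (𝓝 (l (∑ k ∈ s, w k * e (r k)))) := by
      intro r hr
      have hmem : ∀ d ∈ Ioc (0 : ℝ) 1, ∀ k ∈ s, r k + d * (c - r k) ∈ interior I := by
        intro d hd k hk
        have := h.convex.1.combo_self_interior_mem_interior (hr k hk) hc (sub_nonneg.2 hd.2) hd.1
          (by ring)
        convert this using 1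
        simp only [smul_eq_mul]; ring
      refine ⟨hmem, ?_⟩
      have hsum : ∑ k ∈ s, w k * e (r k) ∈ e '' I :=
        hW.sum_mem h.ordConnected_image hw fun k hk => mem_image_of_mem e (hr k hk)
      refine (h.continuousOn_inv _ hsum).tendsto.comp (tendsto_nhdsWithin_iff.2 ⟨?_, ?_⟩)
      · refine tendsto_finsetSum _ fun k hk => Tendsto.const_mul _ ?_
        refine (h.continuous _ (hr k hk)).tendsto.comp (tendsto_nhdsWithin_iff.2 ⟨?_, ?_⟩)
        · have : Continuous fun d : ℝ => r k + d * (c - r k) := by fun_prop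
          simpa using (this.tendsto 0).mono_left nhdsWithin_le_nhds
        · filter_upwards [self_mem_nhdsWithin] with d hd
          exact interior_subset (hmem d hd k hk)
      · filter_upwards [self_mem_nhdsWithin] with d hd
        exact hW.sum_mem h.ordConnected_image hw
          fun k hk => mem_image_of_mem e (interior_subset (hmem d hd k hk))
    have hne : (𝓝[Ioc (0 : ℝ) 1] 0).NeBot := by
      rw [nhdsWithin_Ioc_eq_nhdsGT zero_lt_one]; infer_instance
    refine le_of_tendsto_of_tendsto
      (key (fun k => a * u k + b * v k) fun k hk => h.convex.1 (hu k hk) (hv k hk) ha hb hab).2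
      (((key u hu).2.const_mul a).add ((key v hv).2.const_mul b)) ?_
    filter_upwards [self_mem_nhdsWithin] with d hd
    refine le_of_eq_of_le ?_
      (h.mean_le_of_mem_interior hl hw hW ((key u hu).1 d hd) ((key v hv).1 d hd) ha hb hab)
    congr 1
    refine Finset.sum_congr rfl fun k _ => ?_
    congr 2
    linear_combination (-d * c) * hab

/-- An upper bound for `∑ w e(a u + b v)` in terms of upper bounds for `∑ w e(u)` and
`∑ w e(v)`. -/
lemma IsEllPair.sum_le (h : IsEllPair e l I)
    (hl : ConvexOn ℝ (interior (e '' I)) (ellQuot l)) (hw : ∀ k ∈ s, 0 ≤ w k)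
    (hW : EllScale l (e '' I) (∑ k ∈ s, w k)) {u v : ι → ℝ} (hu : ∀ k ∈ s, u k ∈ I)
    (hv : ∀ k ∈ s, v k ∈ I) {a b : ℝ} (ha : 0 ≤ a) (hb : 0 ≤ b) (hab : a + b = 1)
    {G H : ℝ} (hG : G ∈ e '' I) (hH : H ∈ e '' I) (hGu : ∑ k ∈ s, w k * e (u k) ≤ G)
    (hHv : ∑ k ∈ s, w k * e (v k) ≤ H) :
    ∑ k ∈ s, w k * e (a * u k + b * v k) ≤ e (a * l G + b * l H) := by
  have hmem : ∀ r : ι → ℝ, (∀ k ∈ s, r k ∈ I) → ∑ k ∈ s, w k * e (r k) ∈ e '' I := fun r hr =>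
    hW.sum_mem h.ordConnected_image hw fun k hk => mem_image_of_mem e (hr k hk)
  have hm := hmem (fun k => a * u k + b * v k)
    fun k hk => h.convex.1 (hu k hk) (hv k hk) ha hb hab
  rw [← h.apply_inv hm]
  refine h.strictMono.monotoneOn (h.mapsTo_inv hm)
    (h.convex.1 (h.mapsTo_inv hG) (h.mapsTo_inv hH) ha hb hab) ?_
  refine (h.mean_le hl hw hW hu hv ha hb hab).trans (add_le_add ?_ ?_)
  · exact mul_le_mul_of_nonneg_left (h.monotoneOn_inv (hmem u hu) hG hGu) ha
  · exact mul_le_mul_of_nonneg_left (h.monotoneOn_inv (hmem v hv) hH hHv) hb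

end Mean

/-! ### Gelfand representation of commuting tuples. -/

section Calculus

open WeakDual

/-- The inverse of the Gelfand transform, restricted to real functions. -/
noncomputable def gelfandReal (C : Type*) [CommCStarAlgebra C] :
    C(characterSpace ℂ C, ℝ) →ₐ[ℝ] C :=
  (((gelfandStarTransform C).symm : C(characterSpace ℂ C, ℂ) →⋆ₐ[ℂ] C).toAlgHom.restrictScalars
    ℝ).comp (Complex.ofRealAm.compLeftContinuous ℝ Complex.continuous_ofReal)

lemma apply_gelfandReal {C : Type*} [CommCStarAlgebra C] (h : C(characterSpace ℂ C, ℝ))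
    (φ : characterSpace ℂ C) : φ (gelfandReal C h) = (h φ : ℂ) :=
  DFunLike.congr_fun ((gelfandStarTransform C).apply_symm_apply
    (Complex.ofRealAm.compLeftContinuous ℝ Complex.continuous_ofReal h)) φ

lemma eq_of_forall_character_eq {C : Type*} [CommCStarAlgebra C] {a b : C}
    (h : ∀ φ : characterSpace ℂ C, φ a = φ b) : a = b :=
  (gelfandStarTransform C).injective (ContinuousMap.ext h)

lemma isSelfAdjoint_gelfandReal {C : Type*} [CommCStarAlgebra C] (h : C(characterSpace ℂ C, ℝ)) :
    IsSelfAdjoint (gelfandReal C h) :=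
  eq_of_forall_character_eq fun φ => by
    rw [map_star, apply_gelfandReal]
    exact Complex.conj_ofReal _

lemma exists_gelfandReal_eq {C : Type*} [CommCStarAlgebra C] {a : C} (ha : IsSelfAdjoint a) :
    ∃ h : C(characterSpace ℂ C, ℝ), gelfandReal C h = a ∧ ∀ φ, h φ = (φ a).re := by
  refine ⟨⟨fun φ => (φ a).re, Complex.continuous_re.comp
    (map_continuous (gelfandTransform ℂ C a))⟩, eq_of_forall_character_eq fun φ => ?_, fun _ => rfl⟩
  rw [apply_gelfandReal]
  have h : star (φ a) = φ a := by rw [← map_star, ha.star_eq]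
  exact Complex.conj_eq_iff_re.1 h

/-- Commuting self-adjoint elements and a function of them come from continuous functions on a
compact space. -/
lemma exists_jointCalculus {C : Type u} [CStarAlgebra C] {n : ℕ} {f : (Fin n → ℝ) → ℝ}
    {x : Fin n → C} {K : Fin n → Set ℝ} (hf : ContinuousOn f (univ.pi K))
    (hx : ∀ i, IsSelfAdjoint (x i)) (hc : ∀ i j, Commute (x i) (x j))
    (hK : ∀ i, spectrum ℝ (x i) ⊆ K i) :
    ∃ (X : Type u) (_ : TopologicalSpace X) (_ : CompactSpace X) (Ψ : C(X, ℝ) →ₐ[ℝ] C)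
      (p : Fin n → C(X, ℝ)) (F : C(X, ℝ)), (∀ h, IsSelfAdjoint (Ψ h)) ∧ (∀ i, Ψ (p i) = x i) ∧
        (∀ φ, (fun i => p i φ) ∈ univ.pi K) ∧ (∀ φ, F φ = f fun i => p i φ) ∧
        Ψ F = jointCfc f x := by
  have hcomm : ∀ a ∈ range x, ∀ b ∈ range x, a * b = b * a := by
    rintro _ ⟨i, rfl⟩ _ ⟨j, rfl⟩; exact hc i j
  have hcomm' : ∀ a ∈ range x, ∀ b ∈ range x, a * star b = star b * a := by
    rintro _ ⟨i, rfl⟩ _ ⟨j, rfl⟩; rw [(hx j).star_eq]; exact hc i j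
  have : IsMulCommutative (StarAlgebra.adjoin ℂ (range x)) :=
    StarAlgebra.isMulCommutative_adjoin ℂ hcomm hcomm'
  have hcl : IsClosed (jointAlgebra x : Set C) := StarSubalgebra.isClosed_topologicalClosure _
  let iC : CommCStarAlgebra (jointAlgebra x) :=
    { (StarSubalgebra.cstarAlgebra (jointAlgebra x) (h_closed := hcl) :
        CStarAlgebra (jointAlgebra x)) with
      mul_comm := (StarSubalgebra.commRingTopologicalClosure (StarAlgebra.adjoin ℂ (range x))
        (fun a b => mul_comm' a b)).mul_comm }
  have hsa : ∀ i, IsSelfAdjoint (⟨x i, mem_jointAlgebra x i⟩ : jointAlgebra x) := fun i =>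
    Subtype.ext (hx i)
  choose p hp hpφ using fun i => exists_gelfandReal_eq (hsa i)
  have hpK : ∀ φ, (fun i => p i φ) ∈ univ.pi K := fun φ i _ => by
    change p i φ ∈ K i
    rw [hpφ]
    refine hK i ((spectrum.algebraMap_mem_iff ℂ).1 ?_)
    have h1 : φ ⟨x i, mem_jointAlgebra x i⟩ ∈
        spectrum ℂ (⟨x i, mem_jointAlgebra x i⟩ : jointAlgebra x) :=
      AlgHom.apply_mem_spectrum φ _
    rw [StarSubalgebra.spectrum_eq (hS := hcl)] at h1
    have h2 := (hx i).mem_spectrum_eq_re h1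
    change ((φ ⟨x i, mem_jointAlgebra x i⟩).re : ℂ) ∈ _
    rw [← h2]
    exact h1
  let F : C(characterSpace ℂ (jointAlgebra x), ℝ) :=
    ⟨fun φ => f fun i => p i φ, hf.comp_continuous (by fun_prop) hpK⟩
  let Ψ : C(characterSpace ℂ (jointAlgebra x), ℝ) →ₐ[ℝ] C :=
    ((jointAlgebra x).subtype.toAlgHom.restrictScalars ℝ).comp (gelfandReal (jointAlgebra x))
  refine ⟨characterSpace ℂ (jointAlgebra x), inferInstance, inferInstance, Ψ, p, F, fun h => ?_,
    fun i => congrArg Subtype.val (hp i), hpK, fun _ => rfl, ?_⟩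
  · exact congrArg Subtype.val (isSelfAdjoint_gelfandReal h)
  · refine (existsUnique_isJointCfc hf hx hc hK).unique ⟨(gelfandReal (jointAlgebra x) F).2, ?_⟩
      (isJointCfc_jointCfc hf hx hc hK)
    intro χ
    have h1 := apply_gelfandReal F (CharacterSpace.equivAlgHom.symm χ.toAlgHom)
    refine h1.trans ?_
    simp only [F, ContinuousMap.coe_mk, hpφ]
    rfl

end Calculus

/-! ### Barycenters and partitions of unity. -/

section Barycenter

variable {X : Type*} [TopologicalSpace X] {n : ℕ}

lemma exists_Icc_subset_of_compact [CompactSpace X] [Nonempty X] {K : Set ℝ} (p : C(X, ℝ)) (hp : ∀ φ, p φ ∈ K) :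
    ∃ a ∈ K, ∃ b ∈ K, ∀ φ, p φ ∈ Icc a b := by
  obtain ⟨x, -, hx⟩ := isCompact_univ.exists_isMinOn univ_nonempty p.continuous.continuousOn
  obtain ⟨y, -, hy⟩ := isCompact_univ.exists_isMaxOn univ_nonempty p.continuous.continuousOn
  exact ⟨p x, hp x, p y, hp y, fun φ => ⟨hx (mem_univ φ), hy (mem_univ φ)⟩⟩

/-- The intervals `K i` need not be closed. A compact cube makes the epigraph of `f` closed and `f`
uniformly continuous. -/
lemma exists_cube [CompactSpace X] [Nonempty X] {K : Fin n → Set ℝ} (hK : ∀ i, (K i).OrdConnected)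
    (p : Fin n → C(X, ℝ)) (hp : ∀ φ, (fun i => p i φ) ∈ univ.pi K) :
    ∃ a b : Fin n → ℝ, (∀ φ, (fun i => p i φ) ∈ Icc a b) ∧ Icc a b ⊆ univ.pi K := by
  choose a ha b hb hab using fun i => exists_Icc_subset_of_compact (p i) fun φ => hp φ i (mem_univ i)
  exact ⟨a, b, fun φ => ⟨fun i => (hab i φ).1, fun i => (hab i φ).2⟩,
    fun q hq i _ => (hK i).out (ha i) (hb i) ⟨hq.1 i, hq.2 i⟩⟩

/-- Jensen's inequality for positive linear functionals on `C(X, ℝ)`. -/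
lemma exists_barycenter_of_compact {Q : Set (Fin n → ℝ)} (hQ : IsClosed Q)
    {f : (Fin n → ℝ) → ℝ} (hf : ContinuousOn f Q) (hfc : ConvexOn ℝ Q f)
    {L : C(X, ℝ) →ₗ[ℝ] ℝ} (hL : ∀ h, 0 ≤ h → 0 ≤ L h) (hL1 : 0 < L 1) {p : Fin n → C(X, ℝ)}
    {F : C(X, ℝ)} (hp : ∀ φ, (fun i => p i φ) ∈ Q) (hF : ∀ φ, F φ = f fun i => p i φ) :
    (fun i => L (p i) / L 1) ∈ Q ∧ f (fun i => L (p i) / L 1) ≤ L F / L 1 := by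
  by_contra hcon
  -- If the averaged point lay outside the closed convex epigraph, a linear functional would
  -- separate it. Applying `L` to the resulting pointwise inequality on `X` contradicts the
  -- separation.
  obtain ⟨g, s, hgs, hs⟩ := geometric_hahn_banach_closed_point (E := (Fin n → ℝ) × ℝ)
    (x := (fun i => L (p i) / L 1, L F / L 1)) hfc.convex_epigraph (hQ.epigraph hf) hcon
  have hg : ∀ (v : Fin n → ℝ) (r : ℝ),
      g (v, r) = ∑ i, v i * g (Pi.single i 1, 0) + r * g (0, 1) := by
    intro v r
    have h1 : ((v, r) : (Fin n → ℝ) × ℝ) =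
        ∑ i, v i • ((Pi.single i 1, 0) : (Fin n → ℝ) × ℝ) + r • (0, 1) := by
      ext i
      · simp [Prod.fst_sum, Finset.sum_apply, Pi.single_apply]
      · simp [Prod.snd_sum]
    rw [h1, map_add, map_sum]
    simp only [map_smul, smul_eq_mul]
  have hpos : 0 ≤ s • (1 : C(X, ℝ)) -
      (∑ i, g (Pi.single i 1, 0) • p i + g (0, 1) • F) := by
    intro φ
    have := (hgs ((fun i => p i φ), F φ) ⟨hp φ, (hF φ).ge⟩).le
    rw [hg] at this
    simpa [ContinuousMap.sum_apply, mul_comm] using this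
  have h2 := hL _ hpos
  rw [hg] at hs
  simp only [map_sub, map_add, map_sum, map_smul, smul_eq_mul] at h2
  have h3 := mul_lt_mul_of_pos_right hs hL1
  rw [add_mul, Finset.sum_mul] at h3
  have h4 : ∑ i, L (p i) / L 1 * g (Pi.single i 1, 0) * L 1 =
      ∑ i, g (Pi.single i 1, 0) * L (p i) := Finset.sum_congr rfl fun i _ => by field_simp
  have h5 : L F / L 1 * g (0, 1) * L 1 = g (0, 1) * L F := by field_simp
  rw [h4, h5] at h3
  linarith

lemma apply_eq_zero_of_apply_one_eq_zero [CompactSpace X] {L : C(X, ℝ) →ₗ[ℝ] ℝ} (hL : ∀ h, 0 ≤ h → 0 ≤ L h)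
    (hL1 : L 1 = 0) (h : C(X, ℝ)) : L h = 0 := by
  have h1 := hL (‖h‖ • 1 - h) fun φ => by
    simpa using (le_abs_self _).trans (h.norm_coe_le_norm φ)
  have h2 := hL (‖h‖ • 1 + h) fun φ => by
    have := (neg_abs_le _).trans' (neg_le_neg (h.norm_coe_le_norm φ))
    change 0 ≤ ‖h‖ * 1 + h φ
    linarith
  simp only [map_sub, map_add, map_smul, hL1, smul_zero] at h1 h2
  linarith

lemma exists_barycenter [CompactSpace X] [Nonempty X] {K : Fin n → Set ℝ} (hK : ∀ i, (K i).OrdConnected)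
    {f : (Fin n → ℝ) → ℝ} (hf : ContinuousOn f (univ.pi K)) (hfc : ConvexOn ℝ (univ.pi K) f)
    {L : C(X, ℝ) →ₗ[ℝ] ℝ} (hL : ∀ h, 0 ≤ h → 0 ≤ L h) {p : Fin n → C(X, ℝ)}
    {F : C(X, ℝ)} (hp : ∀ φ, (fun i => p i φ) ∈ univ.pi K) (hF : ∀ φ, F φ = f fun i => p i φ) :
    ∃ q ∈ univ.pi K, (∀ i, L 1 * q i = L (p i)) ∧ L 1 * f q ≤ L F := by
  rcases (hL 1 zero_le_one).eq_or_lt with h0 | h0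
  · obtain ⟨φ⟩ := ‹Nonempty X›
    refine ⟨_, hp φ, fun i => ?_, ?_⟩ <;>
      rw [← h0, zero_mul, apply_eq_zero_of_apply_one_eq_zero hL h0.symm]
  · obtain ⟨a, b, hab, hsub⟩ := exists_cube hK p hp
    obtain ⟨h1, h2⟩ := exists_barycenter_of_compact isClosed_Icc (hf.mono hsub)
      (hfc.subset hsub (convex_Icc a b)) hL h0 hab hF
    refine ⟨_, hsub h1, fun i => mul_div_cancel₀ _ h0.ne', ?_⟩
    rwa [le_div_iff₀ h0, mul_comm] at h2

/-- A partition of unity on which the functions `p i` are almost constant. -/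
lemma exists_partition [CompactSpace X] (p : Fin n → C(X, ℝ)) {δ : ℝ} (hδ : 0 < δ) :
    ∃ (t : Finset X) (h : X → C(X, ℝ)), (∀ k, 0 ≤ h k) ∧ ∑ k ∈ t, h k = 1 ∧
      ∀ k φ, h k φ ≠ 0 → dist (fun i => p i φ) (fun i => p i k) < δ := by
  have hcont : ∀ k, Continuous fun φ => dist (fun i => p i φ) (fun i => p i k) := fun k => by
    fun_prop
  obtain ⟨t, -, ht⟩ := isCompact_univ.elim_nhds_subcover
    (fun k => {φ | dist (fun i => p i φ) (fun i => p i k) < δ})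
    fun k _ => (isOpen_lt (hcont k) continuous_const).mem_nhds (by simpa using hδ)
  -- Tent functions supported where `p` is `δ`-close to its value at `k`; dividing by their sum
  -- gives the partition.
  let b : X → X → ℝ := fun k φ => max 0 (δ - dist (fun i => p i φ) (fun i => p i k))
  have hb0 : ∀ k φ, 0 ≤ b k φ := fun k φ => le_max_left _ _
  have hbc : ∀ k, Continuous (b k) := fun k => continuous_const.max (continuous_const.sub (hcont k))
  have hpos : ∀ φ, 0 < ∑ k ∈ t, b k φ := fun φ => by
    obtain ⟨k, hk, hkφ⟩ := mem_iUnion₂.1 (ht (mem_univ φ))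
    exact Finset.sum_pos' (fun k _ => hb0 k φ) ⟨k, hk, lt_max_of_lt_right (sub_pos.2 hkφ)⟩
  refine ⟨t, fun k => ⟨fun φ => b k φ / ∑ k ∈ t, b k φ, (hbc k).div
    (continuous_finsetSum _ fun k _ => hbc k) fun φ => (hpos φ).ne'⟩,
    fun k φ => div_nonneg (hb0 k φ) (hpos φ).le, ?_, fun k φ hk => ?_⟩
  · ext φ
    simp [ContinuousMap.sum_apply, ← Finset.sum_div, (hpos φ).ne']
  · by_contra hcon
    exact hk (by simp [b, max_eq_left (sub_nonpos.2 (not_lt.1 hcon))])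

end Barycenter

/-- `x₁, …, xₙ` are commuting self-adjoint elements with spectra in `K₁, …, Kₙ`. -/
structure IsJointTuple {C : Type*} [CStarAlgebra C] {n : ℕ} (K : Fin n → Set ℝ) (x : Fin n → C) :
    Prop where
  isSelfAdjoint : ∀ i, IsSelfAdjoint (x i)
  commute : ∀ i j, Commute (x i) (x j)
  spectrum_subset : ∀ i, spectrum ℝ (x i) ⊆ K i

lemma ContinuousMap.exists_mul_self_eq {X : Type*} [TopologicalSpace X] {h : C(X, ℝ)}
    (hh : 0 ≤ h) : ∃ r : C(X, ℝ), r * r = h :=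
  ⟨⟨fun φ => √(h φ), by fun_prop⟩, ContinuousMap.ext fun φ => Real.mul_self_sqrt (hh φ)⟩

lemma EllConvexOn.convexOn {E : Type*} [AddCommGroup E] [Module ℝ E] {e l : ℝ → ℝ} {I : Set ℝ}
    {S : Set E} {F : E → ℝ} (hel : IsEllPair e l I) (hF : EllConvexOn e I S F) :
    ConvexOn ℝ S F := by
  obtain ⟨g, hg, hgI, hFg⟩ := hF
  refine ⟨hg.1, fun x hx y hy a b ha hb hab => ?_⟩
  rw [hFg hx, hFg hy, hFg (hg.1 hx hy ha hb hab)]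
  exact (hel.strictMono.monotoneOn (hgI (hg.1 hx hy ha hb hab))
    (hel.convex.1 (hgI hx) (hgI hy) ha hb hab) (hg.2 hx hy ha hb hab)).trans
    (hel.convex.2 (hgI hx) (hgI hy) ha hb hab)

/-! ### The main inequality for positive functionals. -/

section Functional

variable {C : Type u} [CStarAlgebra C] {n : ℕ} {K : Fin n → Set ℝ} {f : (Fin n → ℝ) → ℝ}

lemma nonneg_conj_of_nonneg {X : Type*} [TopologicalSpace X] {ω : C →ₗ[ℝ] ℝ}
    (hω : ∀ a, 0 ≤ ω (star a * a)) {Ψ : C(X, ℝ) →ₐ[ℝ] C} (hΨ : ∀ h, IsSelfAdjoint (Ψ h)) {d : C}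
    (hd : IsSelfAdjoint d) {h : C(X, ℝ)} (hh : 0 ≤ h) : 0 ≤ ω (d * Ψ h * d) := by
  obtain ⟨r, rfl⟩ := ContinuousMap.exists_mul_self_eq hh
  have := hω (Ψ r * d)
  rwa [star_mul, (hΨ r).star_eq, hd.star_eq, mul_assoc, ← mul_assoc (Ψ r), ← map_mul,
    ← mul_assoc] at this

lemma nonempty_of_algHom [Nontrivial C] {X : Type*} [TopologicalSpace X] (Ψ : C(X, ℝ) →ₐ[ℝ] C) :
    Nonempty X := by
  by_contra hX
  rw [not_nonempty_iff] at hX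
  have h1 : (1 : C(X, ℝ)) = 0 := ContinuousMap.ext fun φ => hX.elim φ
  have h2 := map_one Ψ
  rw [h1, map_zero] at h2
  exact zero_ne_one h2

/-- Jensen's inequality for the positive functional `ω (d · d)` and commuting self-adjoint
elements. -/
lemma IsJointTuple.exists_barycenter [Nontrivial C] (hK : ∀ i, (K i).OrdConnected)
    (hf : ContinuousOn f (univ.pi K)) (hfc : ConvexOn ℝ (univ.pi K) f) {ω : C →ₗ[ℝ] ℝ}
    (hω : ∀ a, 0 ≤ ω (star a * a)) {x : Fin n → C} (hx : IsJointTuple K x) {d : C}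
    (hd : IsSelfAdjoint d) :
    ∃ q ∈ univ.pi K, (∀ i, ω (d * d) * q i = ω (d * x i * d)) ∧
      ω (d * d) * f q ≤ ω (d * jointCfc f x * d) := by
  obtain ⟨X, _, _, Ψ, p, F, hΨ, hp, hpK, hF, hΨF⟩ :=
    exists_jointCalculus hf hx.isSelfAdjoint hx.commute hx.spectrum_subset
  have : Nonempty X := nonempty_of_algHom Ψ
  obtain ⟨q, hq, hq1, hq2⟩ := _root_.exists_barycenter hK hf hfc
    (L := ω ∘ₗ LinearMap.mulLeftRight ℝ (d, d) ∘ₗ Ψ.toLinearMap)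
    (fun h hh => by simpa using nonneg_conj_of_nonneg hω hΨ hd hh) hpK hF
  refine ⟨q, hq, fun i => ?_, ?_⟩
  · simpa [hp] using hq1 i
  · simpa [hΨF] using hq2

/-- If the sums of `ω (d f(x) d)` and of `ω (d f(y) d)` are bounded by `G` and `H` for all
decompositions `∑ d² = 1` of the unit, then `ω (f(a x + b y))` is bounded by the corresponding
value of `e`. -/
lemma apply_jointCfc_le [Nontrivial C] (hK : ∀ i, (K i).OrdConnected)
    (hf : ContinuousOn f (univ.pi K)) {e l : ℝ → ℝ} {I : Set ℝ} (hel : IsEllPair e l I)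
    (hfl : EllConvexOn e I (univ.pi K) f) (hl : ConvexOn ℝ (interior (e '' I)) (ellQuot l))
    {ω : C →ₗ[ℝ] ℝ} (hω : ∀ a, 0 ≤ ω (star a * a)) (hW : EllScale l (e '' I) (ω 1))
    {x y : Fin n → C} {a b : ℝ} (ha : 0 ≤ a) (hb : 0 ≤ b) (hab : a + b = 1)
    (hx : IsJointTuple K x) (hy : IsJointTuple K y) (hz : IsJointTuple K (a • x + b • y))
    {G H : ℝ} (hG : G ∈ e '' I) (hH : H ∈ e '' I)
    (hGx : ∀ (ι : Type u) (t : Finset ι) (d : ι → C), (∀ k, IsSelfAdjoint (d k)) →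
      ∑ k ∈ t, d k * d k = 1 → ∑ k ∈ t, ω (d k * jointCfc f x * d k) ≤ G)
    (hHy : ∀ (ι : Type u) (t : Finset ι) (d : ι → C), (∀ k, IsSelfAdjoint (d k)) →
      ∑ k ∈ t, d k * d k = 1 → ∑ k ∈ t, ω (d k * jointCfc f y * d k) ≤ H) :
    ω (jointCfc f (a • x + b • y)) ≤ e (a * l G + b * l H) := by
  have hfc := hfl.convexOn hel
  obtain ⟨g, hg, hgI, hfg⟩ := hfl
  obtain ⟨X, _, _, Ψ, p, F, hΨ, hp, hpK, hF, hΨF⟩ :=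
    exists_jointCalculus hf hz.isSelfAdjoint hz.commute hz.spectrum_subset
  have : Nonempty X := nonempty_of_algHom Ψ
  obtain ⟨A, B, hAB, hsub⟩ := exists_cube hK p hpK
  have hunif := isCompact_Icc.uniformContinuousOn_of_continuous (hf.mono hsub)
  rw [Metric.uniformContinuousOn_iff] at hunif
  refine le_of_forall_pos_le_add fun ε hε => ?_
  have hη : 0 < ε / (2 * ω 1) := div_pos hε (mul_pos two_pos hW.pos)
  set η := ε / (2 * ω 1) with hη'
  obtain ⟨δ, hδ, hδf⟩ := hunif η hη
  obtain ⟨t, h, h0, h1, hδh⟩ := exists_partition p (half_pos hδ)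
  choose r hr using fun k => ContinuousMap.exists_mul_self_eq (h0 k)
  -- The square roots of the partition functions, evaluated at `z = a x + b y`.
  set d : X → C := fun k => Ψ (r k)
  have hd : ∀ k, IsSelfAdjoint (d k) := fun k => hΨ _
  have hdd : ∀ k, d k * d k = Ψ (h k) := fun k => by rw [← map_mul, hr]
  have hd1 : ∑ k ∈ t, d k * d k = 1 := by
    rw [Finset.sum_congr rfl fun k _ => hdd k, ← map_sum, h1, map_one]
  set w : X → ℝ := fun k => ω (d k * d k)
  have hw : ∀ k, 0 ≤ w k := fun k => by
    have := hω (d k)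
    rwa [(hd k).star_eq] at this
  have hw1 : ∑ k ∈ t, w k = ω 1 := by rw [← map_sum, hd1]
  have hconj : ∀ k c, d k * Ψ c * d k = Ψ (h k * c) := fun k c => by
    rw [← hr, ← map_mul, ← map_mul, mul_right_comm]
  choose u huK hu1 hu2 using fun k => hx.exists_barycenter hK hf hfc hω (hd k)
  choose v hvK hv1 hv2 using fun k => hy.exists_barycenter hK hf hfc hω (hd k)
  have hGsum : ∑ k ∈ t, w k * e (g (u k)) ≤ G :=
    (Finset.sum_le_sum fun k _ => by
      have := hu2 k; rwa [hfg (huK k)] at this).trans (hGx X t d hd hd1)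
  have hHsum : ∑ k ∈ t, w k * e (g (v k)) ≤ H :=
    (Finset.sum_le_sum fun k _ => by
      have := hv2 k; rwa [hfg (hvK k)] at this).trans (hHy X t d hd hd1)
  have hmean := hel.sum_le hl (fun k _ => hw k) (hw1 ▸ hW) (fun k _ => hgI (huK k))
    (fun k _ => hgI (hvK k)) ha hb hab hG hH hGsum hHsum
  -- a function bounded on the support of `h k`
  have hbound : ∀ k (c : C(X, ℝ)) (m : ℝ), (∀ φ, h k φ ≠ 0 → c φ ≤ m) →
      ω (Ψ (h k * c)) ≤ w k * m := by
    intro k c m hc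
    have hnn : 0 ≤ h k * (m • 1 - c) := fun φ => by
      by_cases hφ : h k φ = 0
      · simp [hφ]
      · simpa using mul_nonneg (h0 k φ) (sub_nonneg.2 (hc φ hφ))
    have := nonneg_conj_of_nonneg hω hΨ (.one C) hnn
    rw [one_mul, mul_one, mul_sub, mul_smul_comm, mul_one, map_sub, map_smul, map_sub, map_smul,
      ← hdd, smul_eq_mul] at this
    linarith
  have hterm : ∀ k, ω (d k * Ψ F * d k) ≤ w k * e (a * g (u k) + b * g (v k)) + w k * (2 * η) := by
    intro k
    rw [hconj]
    have hqK : a • u k + b • v k ∈ univ.pi K := hg.1 (huK k) (hvK k) ha hb hab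
    have hfq : f (a • u k + b • v k) ≤ e (a * g (u k) + b * g (v k)) := by
      rw [hfg hqK]
      exact hel.strictMono.monotoneOn (hgI hqK)
        (hel.convex.1 (hgI (huK k)) (hgI (hvK k)) ha hb hab) (hg.2 (huK k) (hvK k) ha hb hab)
    -- A piece of weight zero contributes nothing positive, and its barycenters are undetermined.
    rcases (hw k).eq_or_lt with hk | hk
    · have := hbound k F (sSup (range F)) fun φ _ =>
        le_csSup (isCompact_range F.continuous).bddAbove (mem_range_self φ)
      rw [← hk, zero_mul] at this
      rw [← hk]
      linarith
    -- Linearity of `ω(dₖ · dₖ)`: combining the barycenters of `x` and `y` gives that of `z`.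
    · have hqp : ∀ i, w k * (a • u k + b • v k) i = ω (Ψ (h k * p i)) := fun i => by
        rw [← hconj, hp]
        have e1 := hu1 k i
        have e2 := hv1 k i
        simp only [Pi.add_apply, Pi.smul_apply, smul_eq_mul, mul_add, add_mul, mul_smul_comm,
          smul_mul_assoc, map_add, map_smul, ← e1, ← e2, w]
        ring
      have hup : ∀ i, ∀ m, (∀ φ, h k φ ≠ 0 → p i φ ≤ m) → (a • u k + b • v k) i ≤ m :=
        fun i m hm => by
          have := hbound k (p i) m hm
          rw [← hqp] at this
          exact le_of_mul_le_mul_left this hk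
      have hlow : ∀ i, ∀ m, (∀ φ, h k φ ≠ 0 → m ≤ p i φ) → m ≤ (a • u k + b • v k) i :=
        fun i m hm => by
          have := hbound k (-p i) (-m) fun φ hφ => neg_le_neg (hm φ hφ)
          rw [mul_neg, map_neg, map_neg, ← hqp, mul_neg, neg_le_neg_iff] at this
          exact le_of_mul_le_mul_left this hk
      -- Uniform continuity of `f` is available only on this cube. The two comparisons `f(z)` with
      -- `f(p(k))` and `f(p(k))` with `f(a uₖ + b vₖ)` cost `η` each.
      have hqAB : a • u k + b • v k ∈ Icc A B :=
        ⟨fun i => hlow i _ fun φ _ => (hAB φ).1 i, fun i => hup i _ fun φ _ => (hAB φ).2 i⟩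
      have hdist : ∀ φ, h k φ ≠ 0 → ∀ i, |p i φ - p i k| ≤ δ / 2 := fun φ hφ i =>
        (dist_le_pi_dist (fun i => p i φ) (fun i => p i k) i).trans (hδh k φ hφ).le
      have hqk : dist (fun i => p i k) (a • u k + b • v k) < δ := by
        refine lt_of_le_of_lt ((dist_pi_le_iff (half_pos hδ).le).2 fun i => ?_) (half_lt_self hδ)
        rw [dist_comm, Real.dist_eq, abs_sub_le_iff, sub_le_iff_le_add, sub_le_comm]
        exact ⟨hup i _ fun φ hφ => by linarith [(abs_sub_le_iff.1 (hdist φ hφ i)).1],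
          hlow i _ fun φ hφ => by linarith [(abs_sub_le_iff.1 (hdist φ hφ i)).2]⟩
      have hfk := (abs_lt.1 (hδf _ (hAB k) _ hqAB hqk)).2
      have hF1 := hbound k F (f (fun i => p i k) + η) fun φ hφ => by
        rw [hF]
        have := (abs_lt.1 (hδf _ (hAB φ) _ (hAB k) ((hδh k φ hφ).trans (half_lt_self hδ)))).2
        linarith
      refine hF1.trans ?_
      rw [← mul_add]
      exact mul_le_mul_of_nonneg_left (by linarith) hk.le
  have hsum : ω (jointCfc f (a • x + b • y)) = ∑ k ∈ t, ω (d k * Ψ F * d k) := by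
    rw [Finset.sum_congr rfl fun k _ => by rw [hconj], ← map_sum, ← map_sum, ← Finset.sum_mul, h1,
      one_mul, hΨF]
  rw [hsum]
  refine (Finset.sum_le_sum fun k _ => hterm k).trans ?_
  rw [Finset.sum_add_distrib, ← Finset.sum_mul, hw1]
  have : ω 1 * (2 * η) = ε := by
    have := hW.pos.ne'
    rw [hη']; field_simp
  rw [this]
  exact add_le_add_left hmean ε

end Functional

/-! ### Spectral bounds, positivity and pinching. -/

section Order

variable {C : Type u} [CStarAlgebra C] [PartialOrder C] [StarOrderedRing C] {n : ℕ}
  {K : Fin n → Set ℝ} {f : (Fin n → ℝ) → ℝ}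

lemma exists_bounds_of_spectrum_subset [Nontrivial C] {x : C} (hx : IsSelfAdjoint x) {K : Set ℝ}
    (hK : spectrum ℝ x ⊆ K) :
    ∃ a ∈ K, ∃ b ∈ K, algebraMap ℝ C a ≤ x ∧ x ≤ algebraMap ℝ C b := by
  have hne : (spectrum ℝ x).Nonempty := ContinuousFunctionalCalculus.spectrum_nonempty x hx
  have hcp : IsCompact (spectrum ℝ x) := ContinuousFunctionalCalculus.isCompact_spectrum x
  obtain ⟨a, ha, ha'⟩ := hcp.exists_isLeast hne
  obtain ⟨b, hb, hb'⟩ := hcp.exists_isGreatest hne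
  exact ⟨a, hK ha, b, hK hb, algebraMap_le_of_le_spectrum fun r hr => ha' hr,
    (le_algebraMap_iff_spectrum_le hx).2 fun r hr => hb' hr⟩

/-- An interval containing the spectrum amounts to order bounds by scalars taken from that interval,
and such bounds survive convex combinations. -/
lemma spectrum_convexCombo_subset {x y : C} (hx : IsSelfAdjoint x) (hy : IsSelfAdjoint y)
    {K : Set ℝ} (hK : K.OrdConnected) (hxK : spectrum ℝ x ⊆ K) (hyK : spectrum ℝ y ⊆ K) {a b : ℝ}
    (ha : 0 ≤ a) (hb : 0 ≤ b) (hab : a + b = 1) : spectrum ℝ (a • x + b • y) ⊆ K := by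
  nontriviality C
  obtain ⟨p, hp, q, hq, hpx, hxq⟩ := exists_bounds_of_spectrum_subset hx hxK
  obtain ⟨p', hp', q', hq', hpy, hyq⟩ := exists_bounds_of_spectrum_subset hy hyK
  have hz : IsSelfAdjoint (a • x + b • y) :=
    ((IsSelfAdjoint.all a).smul hx).add ((IsSelfAdjoint.all b).smul hy)
  have hmap : ∀ r s : ℝ, algebraMap ℝ C (a • r + b • s) =
      a • algebraMap ℝ C r + b • algebraMap ℝ C s := fun r s => by
    simp [Algebra.smul_def]
  have h1 : algebraMap ℝ C (a • p + b • p') ≤ a • x + b • y := by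
    rw [hmap]
    exact add_le_add (smul_le_smul_of_nonneg_left hpx ha) (smul_le_smul_of_nonneg_left hpy hb)
  have h2 : a • x + b • y ≤ algebraMap ℝ C (a • q + b • q') := by
    rw [hmap]
    exact add_le_add (smul_le_smul_of_nonneg_left hxq ha) (smul_le_smul_of_nonneg_left hyq hb)
  intro r hr
  exact hK.out (hK.convex hp hp' ha hb hab) (hK.convex hq hq' ha hb hab)
    ⟨(algebraMap_le_iff_le_spectrum hz).1 h1 r hr, (le_algebraMap_iff_spectrum_le hz).1 h2 r hr⟩

lemma IsJointTuple.exists_bounds [Nontrivial C] (hf : ContinuousOn f (univ.pi K)) {x : Fin n → C}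
    (hx : IsJointTuple K x) : ∃ p ∈ univ.pi K, ∃ q ∈ univ.pi K,
      algebraMap ℝ C (f p) ≤ jointCfc f x ∧ jointCfc f x ≤ algebraMap ℝ C (f q) := by
  obtain ⟨X, _, _, Ψ, p, F, hΨ, hp, hpK, hF, hΨF⟩ :=
    exists_jointCalculus hf hx.isSelfAdjoint hx.commute hx.spectrum_subset
  have : Nonempty X := nonempty_of_algHom Ψ
  obtain ⟨y, -, hy⟩ := isCompact_univ.exists_isMinOn univ_nonempty F.continuous.continuousOn
  obtain ⟨z, -, hz⟩ := isCompact_univ.exists_isMaxOn univ_nonempty F.continuous.continuousOn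
  have hpos : ∀ h : C(X, ℝ), 0 ≤ h → 0 ≤ Ψ h := fun h hh => by
    obtain ⟨r, rfl⟩ := ContinuousMap.exists_mul_self_eq hh
    rw [map_mul]
    nth_rewrite 1 [← (hΨ r).star_eq]
    exact star_mul_self_nonneg _
  refine ⟨_, hpK y, _, hpK z, ?_, ?_⟩
  · have := hpos (F - algebraMap ℝ _ (F y)) fun φ => by
      simpa using hy (mem_univ φ)
    rw [map_sub, AlgHom.commutes, hΨF, sub_nonneg] at this
    rwa [← hF]
  · have := hpos (algebraMap ℝ _ (F z) - F) fun φ => by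
      simpa using hz (mem_univ φ)
    rw [map_sub, AlgHom.commutes, hΨF, sub_nonneg] at this
    rwa [← hF]

lemma apply_algebraMap {C : Type*} [CStarAlgebra C] (ω : C →ₗ[ℝ] ℝ) (r : ℝ) :
    ω (algebraMap ℝ C r) = r * ω 1 := by
  rw [Algebra.algebraMap_eq_smul_one, map_smul, smul_eq_mul]

lemma monotone_of_positive {ω : C →ₗ[ℝ] ℝ} (hω : ∀ a, 0 ≤ ω (star a * a)) : Monotone ω := by
  intro a b hab
  obtain ⟨c, hc⟩ := CStarAlgebra.nonneg_iff_eq_star_mul_self.1 (sub_nonneg.2 hab)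
  have := hω c
  rw [← hc, map_sub] at this
  exact sub_nonneg.1 this

/-- After a scalar shift `y = s* s`, and `ω(d s* s d) = ω(s d² s*)` sums to `ω(s s*) = ω(s* s)`. -/
lemma sum_apply_conj_of_tracial {ω : C →ₗ[ℝ] ℝ} (hω : ∀ a, ω (star a * a) = ω (a * star a)) {y : C}
    {m : ℝ} (hy : algebraMap ℝ C m ≤ y) {ι : Type*} {t : Finset ι} {d : ι → C}
    (hd : ∀ k, IsSelfAdjoint (d k)) (hd1 : ∑ k ∈ t, d k * d k = 1) :
    ∑ k ∈ t, ω (d k * y * d k) = ω y := by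
  obtain ⟨s, hs⟩ := CStarAlgebra.nonneg_iff_eq_star_mul_self.1 (sub_nonneg.2 hy)
  obtain rfl : y = star s * s + algebraMap ℝ C m := by rw [← hs]; abel
  have h1 : ∀ k, ω (d k * (star s * s + algebraMap ℝ C m) * d k) =
      ω (s * (d k * d k) * star s + algebraMap ℝ C m * (d k * d k)) := fun k => by
    have h2 := hω (s * d k)
    rw [star_mul, (hd k).star_eq] at h2
    rw [mul_add, add_mul, map_add, map_add, (Algebra.commutes m (d k)).symm]
    simp only [← mul_assoc] at h2 ⊢
    rw [h2]
  rw [Finset.sum_congr rfl fun k _ => h1 k, ← map_sum, Finset.sum_add_distrib, ← Finset.mul_sum,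
    ← Finset.sum_mul, ← Finset.mul_sum, hd1, mul_one, mul_one, map_add, map_add, hω]

end Order

/-! ### Tracial states. -/

section TracialState

variable {A : Type u} [CStarAlgebra A] {n : ℕ} {K : Fin n → Set ℝ} {f : (Fin n → ℝ) → ℝ}
  {B : Fin n → NonUnitalStarSubalgebra ℂ A}

lemma isJointTuple_of_mem_saTuples (hB : MutuallyCommuting B) {x : Fin n → A}
    (hx : x ∈ saTuples B K) : IsJointTuple K x where
  isSelfAdjoint i := (hx i).2.1
  commute i j := by
    rcases eq_or_ne i j with rfl | hij
    · exact Commute.refl _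
    · exact hB i j hij _ (hx i).1 _ (hx j).1
  spectrum_subset i := (hx i).2.2

variable [PartialOrder A] [StarOrderedRing A]

lemma convex_saTuples (hK : ∀ i, (K i).OrdConnected) : Convex ℝ (saTuples B K) := by
  intro x hx y hy a b ha hb hab i
  refine ⟨add_mem ?_ ?_, ?_, ?_⟩
  · simpa using SMulMemClass.smul_mem (a : ℂ) (hx i).1
  · simpa using SMulMemClass.smul_mem (b : ℂ) (hy i).1
  · exact ((IsSelfAdjoint.all a).smul (hx i).2.1).add ((IsSelfAdjoint.all b).smul (hy i).2.1)
  · exact spectrum_convexCombo_subset (hx i).2.1 (hy i).2.1 (hK i) (hx i).2.2 (hy i).2.2 ha hb hab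

/-- Here the total mass is 1, so no homogeneity is required; the convex function is `ℓ(τ(f(x)))`. -/
theorem ellConvexOn_tracialState (hK : ∀ i, (K i).OrdConnected) (hf : ContinuousOn f (univ.pi K))
    {e l : ℝ → ℝ} {I : Set ℝ} (hel : IsEllPair e l I) (hfl : EllConvexOn e I (univ.pi K) f)
    (hl : ConvexOn ℝ (interior (e '' I)) (ellQuot l)) (hB : MutuallyCommuting B)
    {τ : A →ₗ[ℂ] ℂ} (hτ : IsTracialState τ) :
    EllConvexOn e I (saTuples B K) fun x => (τ (jointCfc f x)).re := by
  have : Nontrivial A := by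
    refine nontrivial_of_ne (1 : A) 0 fun h => ?_
    have := hτ.map_one
    rw [h, map_zero] at this
    exact zero_ne_one this
  let ω : A →ₗ[ℝ] ℝ := Complex.reLm ∘ₗ τ.restrictScalars ℝ
  have hωτ : ∀ a, ω a = (τ a).re := fun _ => rfl
  have hω : ∀ a, 0 ≤ ω (star a * a) := fun a =>
    (Complex.le_def.1 (hτ.nonneg _ (star_mul_self_nonneg a))).1
  have hω1 : ω 1 = 1 := by rw [hωτ, hτ.map_one, Complex.one_re]
  have hωt : ∀ a, ω (star a * a) = ω (a * star a) := fun a => by rw [hωτ, hωτ, hτ.tracial]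
  have hJ := hel.ordConnected_image
  have hfJ : ∀ p ∈ univ.pi K, f p ∈ e '' I := by
    obtain ⟨g, -, hgI, hfg⟩ := hfl
    exact fun p hp => ⟨g p, hgI hp, (hfg hp).symm⟩
  have hmem : ∀ x ∈ saTuples B K, ω (jointCfc f x) ∈ e '' I := fun x hx => by
    obtain ⟨p, hp, q, hq, h1, h2⟩ := (isJointTuple_of_mem_saTuples hB hx).exists_bounds hf
    refine hJ.out (hfJ p hp) (hfJ q hq) ⟨?_, ?_⟩
    · simpa [apply_algebraMap, hω1] using monotone_of_positive hω h1
    · simpa [apply_algebraMap, hω1] using monotone_of_positive hω h2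
  have hsum : ∀ x ∈ saTuples B K, ∀ (ι : Type u) (t : Finset ι) (d : ι → A),
      (∀ k, IsSelfAdjoint (d k)) → ∑ k ∈ t, d k * d k = 1 →
      ∑ k ∈ t, ω (d k * jointCfc f x * d k) ≤ ω (jointCfc f x) := fun x hx ι t d hd hd1 => by
    obtain ⟨p, -, -, -, h1, -⟩ := (isJointTuple_of_mem_saTuples hB hx).exists_bounds hf
    exact (sum_apply_conj_of_tracial hωt h1 hd hd1).le
  refine ⟨fun x => l (ω (jointCfc f x)), ⟨convex_saTuples hK, ?_⟩,
    fun x hx => hel.mapsTo_inv (hmem x hx), fun x hx => (hel.apply_inv (hmem x hx)).symm⟩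
  intro x hx y hy a b ha hb hab
  have hz := convex_saTuples hK hx hy ha hb hab
  have hR := hel.convex.1 (hel.mapsTo_inv (hmem x hx)) (hel.mapsTo_inv (hmem y hy)) ha hb hab
  have key := apply_jointCfc_le hK hf hel hfl hl hω (hω1 ▸ EllScale.one l _) ha hb hab
    (isJointTuple_of_mem_saTuples hB hx) (isJointTuple_of_mem_saTuples hB hy)
    (isJointTuple_of_mem_saTuples hB hz) (hmem x hx) (hmem y hy) (hsum x hx) (hsum y hy)
  have := hel.monotoneOn_inv (hmem _ hz) (mem_image_of_mem e hR) key
  rwa [hel.leftInv hR] at this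

end TracialState

/-! ### Weights as suprema of dominated functionals. -/

section Dominated

variable {C : Type u} [CStarAlgebra C] [PartialOrder C] {n : ℕ}
  {K : Fin n → Set ℝ} {f : (Fin n → ℝ) → ℝ}

/-- The positive functional `ω` is dominated by the weight `T`, also after pinching with a
decomposition `∑ d² = 1` of the unit. -/
structure IsDominated (T : C → ℝ≥0∞) (ω : C →ₗ[ℝ] ℝ) : Prop where
  positive : ∀ a, 0 ≤ ω (star a * a)
  sum_le : ∀ y, 0 ≤ y → ∀ (ι : Type u) (t : Finset ι) (d : ι → C), (∀ k, IsSelfAdjoint (d k)) →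
    ∑ k ∈ t, d k * d k = 1 → ENNReal.ofReal (∑ k ∈ t, ω (d k * y * d k)) ≤ T y

lemma IsDominated.le {T : C → ℝ≥0∞} {ω : C →ₗ[ℝ] ℝ} (h : IsDominated T ω) {y : C} (hy : 0 ≤ y) :
    ENNReal.ofReal (ω y) ≤ T y := by
  simpa using h.sum_le y hy PUnit {PUnit.unit} (fun _ => 1) (fun _ => .one C) (by simp)

/-- Ensures that the upper bound is nonnegative when `G` and `H` are, as conversions between `[0,
∞]` and `ℝ` require. -/
lemma IsEllPair.min_le_apply {e l : ℝ → ℝ} {I : Set ℝ} (hel : IsEllPair e l I) {G H : ℝ}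
    (hG : G ∈ e '' I) (hH : H ∈ e '' I) {a b : ℝ} (ha : 0 ≤ a) (hb : 0 ≤ b) (hab : a + b = 1) :
    min G H ≤ e (a * l G + b * l H) := by
  have hm : min G H ∈ e '' I := by rcases min_choice G H with h | h <;> rwa [h]
  rw [← hel.apply_inv hm]
  refine hel.strictMono.monotoneOn (hel.mapsTo_inv hm)
    (hel.convex.1 (hel.mapsTo_inv hG) (hel.mapsTo_inv hH) ha hb hab) ?_
  have h1 := mul_le_mul_of_nonneg_left (hel.monotoneOn_inv hm hG (min_le_left _ _)) ha
  have h2 := mul_le_mul_of_nonneg_left (hel.monotoneOn_inv hm hH (min_le_right _ _)) hb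
  calc l (min G H) = a * l (min G H) + b * l (min G H) := by rw [← add_mul, hab, one_mul]
    _ ≤ _ := add_le_add h1 h2

/-- The `ℓ`-convexity of `x ↦ T (f(x))` for a weight `T` that is a supremum of dominated
functionals. -/
theorem extEllConvexOn_of_isDominated [StarOrderedRing C] [Nontrivial C]
    (hK : ∀ i, (K i).OrdConnected)
    (hf : ContinuousOn f (univ.pi K)) {e l : ℝ → ℝ} {I : Set ℝ} (hel : IsEllPair e l I)
    (hfl : EllConvexOn e I (univ.pi K) f) (hl : ConvexOn ℝ (interior (e '' I)) (ellQuot l))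
    (hhom : HomogeneousEllQuot l (e '' I)) (hf0 : ∀ p ∈ univ.pi K, 0 ≤ f p)
    {T : C → ℝ≥0∞}
    (hT : ∀ y, 0 ≤ y → ∀ c < T y, ∃ ω, IsDominated T ω ∧ c < ENNReal.ofReal (ω y))
    (hT1 : 0 ∉ e '' I → T 1 ≠ 0) {E : Type*} [AddCommGroup E] [Module ℝ E]
    -- The map `j` covers both applications: the identity for unital algebras and the embedding into
    -- the unitization.
    (j : E →ₗ[ℝ] (Fin n → C)) {S : Set E} (hS : Convex ℝ S) (hj : ∀ x ∈ S, IsJointTuple K (j x)) :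
    ExtEllConvexOn e I S fun x => T (jointCfc f (j x)) := by
  have hfJ : ∀ p ∈ univ.pi K, f p ∈ e '' I := by
    obtain ⟨g, -, hgI, hfg⟩ := hfl
    exact fun p hp => ⟨g p, hgI hp, (hfg hp).symm⟩
  have halg : ∀ r : ℝ, 0 ≤ r → 0 ≤ algebraMap ℝ C r := fun r hr => by
    rw [Algebra.algebraMap_eq_smul_one]; exact smul_nonneg hr zero_le_one
  have hnn : ∀ x ∈ S, 0 ≤ jointCfc f (j x) := fun x hx => by
    obtain ⟨p, hp, -, -, h1, -⟩ := (hj x hx).exists_bounds hf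
    exact (halg _ (hf0 p hp)).trans h1
  have hmem : ∀ x ∈ S, T (jointCfc f (j x)) ≠ ∞ → (T (jointCfc f (j x))).toReal ∈ e '' I := by
    intro x hx hfin
    obtain ⟨p, hp, q, hq, h1, h2⟩ := (hj x hx).exists_bounds hf
    -- By scaling, one positive value in `e '' I` puts all positive reals there. Only the value 0 of
    -- the weight then needs care, and this is where nonvanishing of `T 1` enters.
    have hpos : ∀ r ∈ e '' I, 0 < r → ∀ v > 0, v ∈ e '' I := fun r hr hr0 v hv => by
      have := hhom.1 (v / r) (div_pos hv hr0) r hr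
      rwa [div_mul_cancel₀ _ hr0.ne'] at this
    rcases eq_or_ne (T (jointCfc f (j x))) 0 with h0 | h0
    · rw [h0, ENNReal.toReal_zero]
      by_contra h0J
      have hfp : 0 < f p := (hf0 p hp).lt_of_ne fun h => h0J (h ▸ hfJ p hp)
      obtain ⟨ω, hω, hω1⟩ := hT 1 zero_le_one 0 (pos_iff_ne_zero.2 (hT1 h0J))
      have h3 := hω.le (hnn x hx)
      have h4 := monotone_of_positive hω.positive h1
      rw [h0, nonpos_iff_eq_zero, ENNReal.ofReal_eq_zero] at h3
      rw [apply_algebraMap] at h4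
      exact absurd (h4.trans h3) (not_le.2 (mul_pos hfp (ENNReal.ofReal_pos.1 hω1)))
    · obtain ⟨ω, hω, hω1⟩ := hT _ (hnn x hx) 0 (pos_iff_ne_zero.2 h0)
      have h4 := monotone_of_positive hω.positive h2
      rw [apply_algebraMap] at h4
      have h5 := (ENNReal.ofReal_pos.1 hω1).trans_le h4
      have hfq : 0 < f q := (hf0 q hq).lt_of_ne fun h => by
        rw [← h, zero_mul] at h5
        exact lt_irrefl _ h5
      exact hpos _ (hfJ q hq) hfq _ (ENNReal.toReal_pos h0 hfin)
  have key : ∀ x ∈ S, T (jointCfc f (j x)) ≠ ∞ → ∀ y ∈ S, T (jointCfc f (j y)) ≠ ∞ →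
      ∀ a b : ℝ, 0 ≤ a → 0 ≤ b → a + b = 1 → T (jointCfc f (j (a • x + b • y))) ≤ ENNReal.ofReal
        (e (a * l (T (jointCfc f (j x))).toReal + b * l (T (jointCfc f (j y))).toReal)) := by
    intro x hx hxT y hy hyT a b ha hb hab
    have hz := hS hx hy ha hb hab
    have hGx := hmem x hx hxT
    have hHy := hmem y hy hyT
    refine le_of_forall_lt fun c hc => ?_
    obtain ⟨ω, hω, hωc⟩ := hT _ (hnn _ hz) c hc
    refine hωc.trans_le (ENNReal.ofReal_le_ofReal ?_)
    have hω0 : 0 ≤ ω 1 := by simpa using hω.positive 1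
    -- A functional of mass zero admits no scaling, but then `ω(f(z)) ≤ 0`.
    rcases hω0.eq_or_lt with h0 | h0
    · obtain ⟨p, hp, q, hq, h1, h2⟩ := (hj _ hz).exists_bounds hf
      have h3 := monotone_of_positive hω.positive h2
      rw [apply_algebraMap, ← h0, mul_zero] at h3
      exact h3.trans ((le_min ENNReal.toReal_nonneg ENNReal.toReal_nonneg).trans
        (hel.min_le_apply hGx hHy ha hb hab))
    · have hlin : j (a • x + b • y) = a • j x + b • j y := by simp
      have hjz := hj _ hz
      rw [hlin] at hjz ⊢
      exact apply_jointCfc_le hK hf hel hfl hl hω.positive (hhom.ellScale h0) ha hb hab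
        (hj x hx) (hj y hy) hjz hGx hHy
        (fun ι t d hd hd1 => (ENNReal.ofReal_le_iff_le_toReal hxT).1
          (hω.sum_le _ (hnn x hx) ι t d hd hd1))
        (fun ι t d hd hd1 => (ENNReal.ofReal_le_iff_le_toReal hyT).1
          (hω.sum_le _ (hnn y hy) ι t d hd hd1))
  refine ⟨hS, fun x => l (T (jointCfc f (j x))).toReal, ⟨?_, ?_⟩,
    fun x hx => hel.mapsTo_inv (hmem x hx.1 hx.2),
    fun x hx => (hel.apply_inv (hmem x hx.1 hx.2)).symm⟩
  · intro x hx y hy a b ha hb hab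
    exact ⟨hS hx.1 hy.1 ha hb hab,
      ((key x hx.1 hx.2 y hy.1 hy.2 a b ha hb hab).trans_lt ENNReal.ofReal_lt_top).ne⟩
  · intro x hx y hy a b ha hb hab
    have hGx := hmem x hx.1 hx.2
    have hHy := hmem y hy.1 hy.2
    have hk := key x hx.1 hx.2 y hy.1 hy.2 a b ha hb hab
    have hR := hel.convex.1 (hel.mapsTo_inv hGx) (hel.mapsTo_inv hHy) ha hb hab
    have hk' := ENNReal.toReal_le_of_le_ofReal
      ((le_min ENNReal.toReal_nonneg ENNReal.toReal_nonneg).trans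
        (hel.min_le_apply hGx hHy ha hb hab)) hk
    have := hel.monotoneOn_inv (hmem _ (hS hx.1 hy.1 ha hb hab)
      (hk.trans_lt ENNReal.ofReal_lt_top).ne) (mem_image_of_mem e hR) hk'
    rwa [hel.leftInv hR] at this

end Dominated

/-! ### Linear extension from the positive cone. -/

section Extension

variable {C : Type*} [CStarAlgebra C] [PartialOrder C] [StarOrderedRing C]

/-- A finite additive and positively homogeneous function on the positive cone extends to a linear
functional. -/
lemma exists_linearMap_of_additive {T : C → ℝ≥0∞} (hfin : ∀ a, 0 ≤ a → T a ≠ ∞)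
    (hadd : ∀ a b, 0 ≤ a → 0 ≤ b → T (a + b) = T a + T b)
    (hsmul : ∀ (r : ℝ≥0) (a : C), 0 ≤ a → T ((r : ℝ) • a) = r * T a) :
    ∃ ω : C →ₗ[ℝ] ℝ, ∀ a, 0 ≤ a → ω a = (T a).toReal := by
  set S : C → ℝ := fun a => (T a).toReal
  have hS : ∀ a b, 0 ≤ a → 0 ≤ b → S (a + b) = S a + S b := fun a b ha hb => by
    simp only [S, hadd a b ha hb, ENNReal.toReal_add (hfin a ha) (hfin b hb)]
  have hSr : ∀ (r : ℝ) (a : C), 0 ≤ r → 0 ≤ a → S (r • a) = r * S a := fun r a hr ha => by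
    have := hsmul ⟨r, hr⟩ a ha
    change T (r • a) = _ at this
    simp only [S, this, ENNReal.toReal_mul]
    rfl
  have hdec : ∀ a : C, ∃ p q : C, 0 ≤ p ∧ 0 ≤ q ∧ ((realPart a : selfAdjoint C) : C) = p - q :=
    fun a => ⟨_, _, CFC.posPart_nonneg _, CFC.negPart_nonneg _,
      (CFC.posPart_sub_negPart _ (realPart a).2).symm⟩
  choose P Q hP hQ hPQ using hdec
  -- By additivity, `S p - S q` is the same for every decomposition of the real part; linearity
  -- follows by choosing convenient decompositions.
  have hwd : ∀ a p q : C, 0 ≤ p → 0 ≤ q → ((realPart a : selfAdjoint C) : C) = p - q →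
      S (P a) - S (Q a) = S p - S q := fun a p q hp hq h => by
    rw [hPQ, sub_eq_sub_iff_add_eq_add] at h
    have := congrArg S h
    rw [hS _ _ (hP a) hq, hS _ _ hp (hQ a)] at this
    linarith
  refine ⟨{ toFun := fun a => S (P a) - S (Q a), map_add' := fun a b => ?_,
            map_smul' := fun r a => ?_ }, fun a ha => ?_⟩
  · rw [hwd (a + b) (P a + P b) (Q a + Q b) (add_nonneg (hP a) (hP b)) (add_nonneg (hQ a) (hQ b)),
      hS _ _ (hP a) (hP b), hS _ _ (hQ a) (hQ b)]
    · ring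
    · rw [map_add, AddSubgroup.coe_add, hPQ, hPQ]; abel
  · rw [RingHom.id_apply, smul_eq_mul]
    rcases le_total 0 r with hr | hr
    · rw [hwd (r • a) (r • P a) (r • Q a) (smul_nonneg hr (hP a)) (smul_nonneg hr (hQ a)),
        hSr _ _ hr (hP a), hSr _ _ hr (hQ a)]
      · ring
      · rw [map_smul, selfAdjoint.val_smul, hPQ, smul_sub]
    · have hr' := neg_nonneg.2 hr
      rw [hwd (r • a) (-r • Q a) (-r • P a) (smul_nonneg hr' (hQ a)) (smul_nonneg hr' (hP a)),
        hSr _ _ hr' (hP a), hSr _ _ hr' (hQ a)]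
      · ring
      · rw [map_smul, selfAdjoint.val_smul, hPQ, smul_sub, neg_smul, neg_smul]; abel
  · have h0 : S 0 = 0 := by simpa using hSr 0 0 le_rfl le_rfl
    have := hwd a a 0 ha le_rfl (by rw [sub_zero]; exact (IsSelfAdjoint.of_nonneg ha).coe_realPart)
    rw [h0, sub_zero] at this
    exact this

end Extension

/-! ### Densely defined traces: general facts and the unital case. -/

namespace IsDenseLscTrace

lemma mono {A : Type*} [NonUnitalCStarAlgebra A] [PartialOrder A] [StarOrderedRing A]
    {τ : A → ℝ≥0∞} (hτ : IsDenseLscTrace τ) {a b : A} (ha : 0 ≤ a) (hab : a ≤ b) : τ a ≤ τ b := by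
  have := hτ.map_add a (b - a) ha (sub_nonneg.2 hab)
  rw [add_sub_cancel] at this
  rw [this]
  exact le_self_add

lemma map_finsetSum {A : Type*} [NonUnitalCStarAlgebra A] [PartialOrder A] [StarOrderedRing A]
    {τ : A → ℝ≥0∞} (hτ : IsDenseLscTrace τ) {ι : Type*} (t : Finset ι) {a : ι → A}
    (ha : ∀ k, 0 ≤ a k) : τ (∑ k ∈ t, a k) = ∑ k ∈ t, τ (a k) := by
  classical
  induction t using Finset.induction_on with
  | empty => simpa using hτ.map_zero
  | insert k t hk ih =>
    rw [Finset.sum_insert hk, Finset.sum_insert hk,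
      hτ.map_add _ _ (ha k) (Finset.sum_nonneg fun k _ => ha k), ih]

section Unital

variable {A : Type u} [CStarAlgebra A] [PartialOrder A] [StarOrderedRing A] {τ : A → ℝ≥0∞}

/-- A positive `a` of finite trace within distance `1/2` of the unit satisfies `1 ≤ 2a`. -/
lemma apply_one_ne_top (hτ : IsDenseLscTrace τ) : τ 1 ≠ ∞ := by
  obtain ⟨a, ⟨ha, haτ⟩, hdist⟩ := Metric.mem_closure_iff.1 (hτ.dense (zero_le_one (α := A))) (1 / 2)
    (by norm_num)
  rw [dist_eq_norm] at hdist
  have h1 : (1 : A) - a ≤ algebraMap ℝ A (1 / 2) :=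
    (IsSelfAdjoint.le_algebraMap_norm_self (a := 1 - a)
      ((IsSelfAdjoint.one A).sub (.of_nonneg ha))).trans (algebraMap_mono A hdist.le)
  have h2 : (1 : A) ≤ (((2 : ℝ≥0) : ℝ)) • a := by
    rw [Algebra.algebraMap_eq_smul_one, sub_le_iff_le_add] at h1
    have h3 := smul_le_smul_of_nonneg_left h1 (zero_le_two (α := ℝ))
    rw [smul_add, smul_smul, mul_one_div_cancel two_ne_zero, one_smul, two_smul] at h3
    exact le_of_add_le_add_left h3
  have h4 := hτ.mono zero_le_one h2
  rw [hτ.map_smul 2 a ha] at h4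
  exact ne_top_of_le_ne_top (ENNReal.mul_ne_top ENNReal.coe_ne_top haτ.ne) h4

lemma le_norm_mul_apply_one (hτ : IsDenseLscTrace τ) {a : A} (ha : 0 ≤ a) :
    τ a ≤ ‖a‖₊ * τ 1 := by
  rw [← hτ.map_smul ‖a‖₊ 1 zero_le_one]
  refine hτ.mono ha ?_
  rw [coe_nnnorm, ← Algebra.algebraMap_eq_smul_one]
  exact IsSelfAdjoint.le_algebraMap_norm_self (.of_nonneg ha)

/-- A trace on a unital algebra is finite here, so its own linear extension serves for every `y` and
`c`. -/
lemma exists_isDominated (hτ : IsDenseLscTrace τ) {y : A} (hy : 0 ≤ y) {c : ℝ≥0∞}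
    (hc : c < τ y) : ∃ ω, IsDominated τ ω ∧ c < ENNReal.ofReal (ω y) := by
  have hfin : ∀ a, 0 ≤ a → τ a ≠ ∞ := fun a ha =>
    ne_top_of_le_ne_top (ENNReal.mul_ne_top ENNReal.coe_ne_top hτ.apply_one_ne_top)
      (hτ.le_norm_mul_apply_one ha)
  obtain ⟨ω, hω⟩ := exists_linearMap_of_additive hfin hτ.map_add hτ.map_smul
  have hωτ : ∀ a, 0 ≤ a → ENNReal.ofReal (ω a) = τ a := fun a ha => by
    rw [hω a ha, ENNReal.ofReal_toReal (hfin a ha)]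
  refine ⟨ω, ⟨fun a => ?_, fun a ha ι t d hd hd1 => ?_⟩, by rwa [hωτ y hy]⟩
  · rw [hω _ (star_mul_self_nonneg a)]
    exact ENNReal.toReal_nonneg
  · rw [sum_apply_conj_of_tracial (m := 0) (fun a => ?_) (by simpa using ha) hd hd1, hωτ a ha]
    rw [hω _ (star_mul_self_nonneg a), hω _ (mul_star_self_nonneg a), hτ.tracial]

end Unital

/-! ### Compressions of the trace on the unitization. -/

section NonUnital

variable {A : Type u} [NonUnitalCStarAlgebra A] [PartialOrder A] [StarOrderedRing A]
  {τ : A → ℝ≥0∞}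

/-- The element `v* y v` of the ideal `A` of its unitization. -/
noncomputable def compress {A : Type*} [NonUnitalCStarAlgebra A] (v : A) (y : Unitization ℂ A) :
    A :=
  y.fst • (star v * v) + star v * y.snd * v

lemma inr_compress {A : Type*} [NonUnitalCStarAlgebra A] (v : A) (y : Unitization ℂ A) :
    (Unitization.inr (compress v y) : Unitization ℂ A) =
      star (Unitization.inr v) * y * Unitization.inr v := by
  rw [← Unitization.inr_star]
  ext
  · simp
  · simp [compress, add_mul, smul_mul_assoc]

lemma compress_add {A : Type*} [NonUnitalCStarAlgebra A] (v : A) (y z : Unitization ℂ A) :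
    compress v (y + z) = compress v y + compress v z := by
  simp only [compress, Unitization.fst_add, Unitization.snd_add, add_smul, mul_add, add_mul]
  abel

lemma compress_smul {A : Type*} [NonUnitalCStarAlgebra A] (v : A) (r : ℝ) (y : Unitization ℂ A) :
    compress v (r • y) = r • compress v y := by
  simp only [compress, Unitization.fst_smul, Unitization.snd_smul, smul_add, mul_smul_comm,
    smul_mul_assoc, smul_assoc]

lemma compress_nonneg (v : A) {y : Unitization ℂ A} (hy : 0 ≤ y) : 0 ≤ compress v y := by
  rw [← Unitization.inr_nonneg_iff, inr_compress]
  exact star_left_conjugate_nonneg hy _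

lemma compress_le (v : A) {y : Unitization ℂ A} (hy : 0 ≤ y) :
    compress v y ≤ ‖y‖ • (star v * v) := by
  rw [← Unitization.inr_le_iff _ _ (.of_nonneg (compress_nonneg v hy))
    ((IsSelfAdjoint.all _).smul (.star_mul_self v)), inr_compress, Unitization.inr_smul,
    Unitization.inr_mul, Unitization.inr_star]
  exact CStarAlgebra.star_left_conjugate_le_norm_smul (.of_nonneg hy)

lemma exists_inr_eq_mul_inr {A : Type*} [NonUnitalCStarAlgebra A] (z : Unitization ℂ A) (v : A) :
    ∃ m : A, (Unitization.inr m : Unitization ℂ A) = z * Unitization.inr v :=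
  ⟨z.fst • v + z.snd * v, by ext <;> simp⟩

/-- The functional `τ (v* · v)` on the unitization is dominated by the extended trace. -/
lemma exists_isDominated_compress (hτ : IsDenseLscTrace τ) {v : A} (hv : ‖v‖ ≤ 1)
    (hvτ : τ (star v * v) ≠ ∞) : ∃ ω, IsDominated (traceExt τ) ω ∧
      ∀ y, 0 ≤ y → ENNReal.ofReal (ω y) = τ (compress v y) := by
  have hfin : ∀ y : Unitization ℂ A, 0 ≤ y → τ (compress v y) ≠ ∞ := fun y hy => by
    refine ne_top_of_le_ne_top ?_ (hτ.mono (compress_nonneg v hy) (compress_le v hy))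
    have := hτ.map_smul ‖y‖₊ _ (star_mul_self_nonneg v)
    rw [coe_nnnorm] at this
    rw [this]
    exact ENNReal.mul_ne_top ENNReal.coe_ne_top hvτ
  obtain ⟨ω, hω⟩ := exists_linearMap_of_additive hfin
    (fun y z hy hz => by
      rw [compress_add, hτ.map_add _ _ (compress_nonneg v hy) (compress_nonneg v hz)])
    (fun r y hy => by rw [compress_smul, hτ.map_smul _ _ (compress_nonneg v hy)])
  have hωτ : ∀ y, 0 ≤ y → ENNReal.ofReal (ω y) = τ (compress v y) := fun y hy => by
    rw [hω y hy, ENNReal.ofReal_toReal (hfin y hy)]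
  refine ⟨ω, ⟨fun a => ?_, fun y hy ι t d hd hd1 => ?_⟩, hωτ⟩
  · rw [hω _ (star_mul_self_nonneg a)]
    exact ENNReal.toReal_nonneg
  · set s := CFC.sqrt y
    have hs : IsSelfAdjoint s := .of_nonneg (CFC.sqrt_nonneg y)
    have hss : s * s = y := CFC.sqrt_mul_sqrt_self y
    have hdy : ∀ k, 0 ≤ d k * y * d k := fun k => by
      have := star_left_conjugate_nonneg hy (d k)
      rwa [(hd k).star_eq] at this
    -- With `m = √y d v`, which lies in the ideal `A`, the trace property swaps `m* m` for `m m* =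
    -- √y d v v* d √y`. As `v v* ≤ 1` and `∑ d² = 1`, these sum to at most `y`.
    choose m hm using fun k => exists_inr_eq_mul_inr (s * d k) v
    have hm1 : ∀ k, compress v (d k * y * d k) = star (m k) * m k := fun k => by
      apply Unitization.inr_injective (R := ℂ)
      rw [inr_compress, Unitization.inr_mul, Unitization.inr_star, hm, star_mul, star_mul,
        hs.star_eq, (hd k).star_eq, ← hss]
      simp only [mul_assoc]
    have hv1 : (Unitization.inr v : Unitization ℂ A) * star (Unitization.inr v) ≤ 1 := by
      rw [← CStarAlgebra.norm_le_one_iff_of_nonneg _ (mul_star_self_nonneg _),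
        CStarRing.norm_self_mul_star, Unitization.norm_inr]
      exact mul_le_one₀ hv (norm_nonneg _) hv
    have hm2 : (Unitization.inr (∑ k ∈ t, m k * star (m k)) : Unitization ℂ A) ≤ y := by
      have h1 : (Unitization.inr (∑ k ∈ t, m k * star (m k)) : Unitization ℂ A) =
          ∑ k ∈ t, (s * d k) * (Unitization.inr v * star (Unitization.inr v)) * star (s * d k) := by
        rw [← Unitization.inrHom_apply ℂ, map_sum]
        refine Finset.sum_congr rfl fun k _ => ?_
        rw [Unitization.inrHom_apply, Unitization.inr_mul, Unitization.inr_star, hm, star_mul]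
        simp only [mul_assoc]
      have h2 : y = ∑ k ∈ t, (s * d k) * 1 * star (s * d k) := by
        have h3 : ∀ k, (s * d k) * 1 * star (s * d k) = s * (d k * d k) * s := fun k => by
          rw [star_mul, hs.star_eq, (hd k).star_eq]
          simp only [mul_assoc, one_mul]
        rw [Finset.sum_congr rfl fun k _ => h3 k, ← Finset.sum_mul, ← Finset.mul_sum, hd1, mul_one,
          hss]
      rw [h1, h2]
      exact Finset.sum_le_sum fun k _ => star_right_conjugate_le_conjugate hv1 _
    rw [ENNReal.ofReal_sum_of_nonneg fun k _ => by
      rw [hω _ (hdy k)]; exact ENNReal.toReal_nonneg]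
    rw [Finset.sum_congr rfl fun k _ => (hωτ _ (hdy k)).trans (by rw [hm1, hτ.tracial]),
      ← hτ.map_finsetSum t fun k => mul_star_self_nonneg (m k)]
    exact le_iSup_of_le _ (le_iSup_of_le
      (Finset.sum_nonneg fun k _ => mul_star_self_nonneg (m k)) (le_iSup_of_le hm2 le_rfl))

/-- Positive contractions with finite trace approximate the unit. -/
lemma exists_contraction_mem (hτ : IsDenseLscTrace τ) (a : A) {U : Set A} (hU : IsOpen U)
    (haU : a ∈ U) : ∃ v : A, 0 ≤ v ∧ ‖v‖ ≤ 1 ∧ τ v ≠ ∞ ∧ v * a * v ∈ U := by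
  have hl := CStarAlgebra.increasingApproximateUnit A
  have := hl.neBot
  have hlim : Tendsto (fun v => v * a * v) (CStarAlgebra.approximateUnit A) (𝓝 a) := by
    have h1 := hl.tendsto_mul_left a
    have h2 := hl.tendsto_mul_right a
    rw [tendsto_iff_norm_sub_tendsto_zero] at h1 h2 ⊢
    have h3 := h1.add h2
    rw [add_zero] at h3
    refine squeeze_zero' (.of_forall fun _ => norm_nonneg _) ?_ h3
    filter_upwards [hl.eventually_norm] with v hv
    have : v * a * v - a = v * (a * v - a) + (v * a - a) := by rw [mul_sub, mul_assoc]; abel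
    rw [this]
    refine (norm_add_le _ _).trans (add_le_add_left ?_ _)
    exact (norm_mul_le _ _).trans (mul_le_of_le_one_left (norm_nonneg _) hv)
  obtain ⟨v, hvU, hv0, hv1⟩ :=
    ((hlim.eventually (hU.mem_nhds haU)).and (hl.eventually_nonneg.and hl.eventually_norm)).exists
  set V : Set A := (fun v => v * a * v) ⁻¹' U with hV
  have hVo : IsOpen V := hU.preimage (by fun_prop)
  -- Shrinking `v` slightly moves it into the open unit ball, where density supplies a nearby
  -- contraction of finite trace.
  have hscale : Tendsto (fun r : ℝ => r • v) (𝓝[<] 1) (𝓝 v) := by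
    have : Continuous fun r : ℝ => r • v := by fun_prop
    simpa using (this.tendsto 1).mono_left nhdsWithin_le_nhds
  obtain ⟨r, hrV, hr1, hr0⟩ := ((hscale.eventually (hVo.mem_nhds hvU)).and
    ((eventually_mem_nhdsWithin (s := Iio (1 : ℝ))).and
      (Ioo_mem_nhdsLT (zero_lt_one (α := ℝ))))).exists
  have hr0' : 0 < r := hr0.1
  have hr1' : r < 1 := hr1
  have hball : r • v ∈ Metric.ball (0 : A) 1 := by
    rw [mem_ball_zero_iff, norm_smul, Real.norm_of_nonneg hr0'.le]
    nlinarith [norm_nonneg v]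
  obtain ⟨w, ⟨hwV, hwb⟩, hw0, hwτ⟩ := mem_closure_iff.1 (hτ.dense (smul_nonneg hr0'.le hv0)) _
    (hVo.inter Metric.isOpen_ball) ⟨hrV, hball⟩
  exact ⟨w, hw0, (mem_ball_zero_iff.1 hwb).le, hwτ.ne, hwV⟩

/-- For positive `v` one has `v² ≤ ‖v‖ v`. -/
lemma apply_mul_self_ne_top (hτ : IsDenseLscTrace τ) {v : A} (hv : 0 ≤ v) (hvτ : τ v ≠ ∞) :
    τ (star v * v) ≠ ∞ := by
  have hs : IsSelfAdjoint (CFC.sqrt v) := .of_nonneg (CFC.sqrt_nonneg v)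
  have hss : CFC.sqrt v * CFC.sqrt v = v := CFC.sqrt_mul_sqrt_self v
  have h1 : star v * v ≤ ‖v‖ • v := by
    have := CStarAlgebra.star_left_conjugate_le_norm_smul (a := CFC.sqrt v) (b := v) (.of_nonneg hv)
    rw [hs.star_eq, hss] at this
    refine le_of_eq_of_le ?_ this
    rw [(IsSelfAdjoint.of_nonneg hv).star_eq]
    calc v * v = CFC.sqrt v * CFC.sqrt v * (CFC.sqrt v * CFC.sqrt v) := by rw [hss]
      _ = CFC.sqrt v * (CFC.sqrt v * CFC.sqrt v) * CFC.sqrt v := by simp only [mul_assoc]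
      _ = CFC.sqrt v * v * CFC.sqrt v := by rw [hss]
  have h2 := hτ.mono (star_mul_self_nonneg v) h1
  have h3 := hτ.map_smul ‖v‖₊ v hv
  rw [coe_nnnorm] at h3
  rw [h3] at h2
  exact ne_top_of_le_ne_top (ENNReal.mul_ne_top ENNReal.coe_ne_top hvτ) h2

/-- Choose `0 ≤ a ≤ y` in `A` with `c < τ(a)`. Lower semicontinuity preserves this for `v a v` with
`v` close to a unit, and `v a v ≤ v y v`. -/
lemma exists_isDominated_traceExt (hτ : IsDenseLscTrace τ) {y : Unitization ℂ A} (hy : 0 ≤ y)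
    {c : ℝ≥0∞} (hc : c < traceExt τ y) :
    ∃ ω, IsDominated (traceExt τ) ω ∧ c < ENNReal.ofReal (ω y) := by
  simp only [traceExt, lt_iSup_iff] at hc
  obtain ⟨a, ha, hay, hca⟩ := hc
  obtain ⟨U, hUo, haU, hU⟩ := mem_nhdsWithin.1 (hτ.lsc a ha c hca)
  obtain ⟨v, hv0, hv1, hvτ, hvU⟩ := hτ.exists_contraction_mem a hUo haU
  have hvs : IsSelfAdjoint v := .of_nonneg hv0
  obtain ⟨ω, hω, hωτ⟩ := hτ.exists_isDominated_compress hv1 (hτ.apply_mul_self_ne_top hv0 hvτ)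
  have hva : 0 ≤ v * a * v := by
    have := star_left_conjugate_nonneg ha v
    rwa [hvs.star_eq] at this
  refine ⟨ω, hω, ?_⟩
  rw [hωτ y hy]
  refine lt_of_lt_of_le (hU ⟨hvU, hva⟩) (hτ.mono hva ?_)
  rw [← Unitization.inr_le_iff _ _ (.of_nonneg hva) (.of_nonneg (compress_nonneg v hy)),
    inr_compress, Unitization.inr_mul, Unitization.inr_mul]
  have := star_left_conjugate_le_conjugate hay (Unitization.inr v : Unitization ℂ A)
  rwa [← Unitization.inr_star, hvs.star_eq] at this ⊢

lemma traceExt_one_ne_zero (hτ : IsDenseLscTrace τ) {a : A} (ha : 0 ≤ a) (haτ : τ a ≠ 0) :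
    traceExt τ 1 ≠ 0 := by
  have ha0 : ‖a‖₊ ≠ 0 := fun h => haτ (by rw [nnnorm_eq_zero.1 h, hτ.map_zero])
  have hb : 0 ≤ ((‖a‖₊⁻¹ : ℝ≥0) : ℝ) • a := smul_nonneg (NNReal.coe_nonneg _) ha
  have hb1 : (Unitization.inr (((‖a‖₊⁻¹ : ℝ≥0) : ℝ) • a) : Unitization ℂ A) ≤ 1 := by
    rw [← CStarAlgebra.norm_le_one_iff_of_nonneg _ (Unitization.inr_nonneg_iff.2 hb),
      Unitization.norm_inr, norm_smul, NNReal.coe_inv, coe_nnnorm, norm_inv, norm_norm,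
      inv_mul_cancel₀ (by simpa using ha0)]
  have h1 : τ (((‖a‖₊⁻¹ : ℝ≥0) : ℝ) • a) ≤ traceExt τ 1 :=
    le_iSup_of_le _ (le_iSup_of_le hb (le_iSup_of_le hb1 le_rfl))
  rw [hτ.map_smul _ _ ha] at h1
  refine fun h => mul_ne_zero ?_ haτ (nonpos_iff_eq_zero.1 (h ▸ h1))
  simpa using ha0

end NonUnital

end IsDenseLscTrace

/-! ### Tuples in the unitization and the final assembly. -/

section Tuples

variable {A : Type u} [NonUnitalCStarAlgebra A] {n : ℕ} {K : Fin n → Set ℝ}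
  {B : Fin n → NonUnitalStarSubalgebra ℂ A}

lemma isJointTuple_inr_of_mem (hB : MutuallyCommuting B) {x : Fin n → A}
    (hx : x ∈ saTuplesNonUnital B K) :
    IsJointTuple K fun i => (Unitization.inr (x i) : Unitization ℂ A) where
  isSelfAdjoint i := Unitization.isSelfAdjoint_inr.2 (hx i).2.1
  commute i j := by
    rcases eq_or_ne i j with rfl | hij
    · exact Commute.refl _
    · have := hB i j hij _ (hx i).1 _ (hx j).1
      rw [commute_iff_eq] at this ⊢
      rw [← Unitization.inr_mul, ← Unitization.inr_mul, this]
  spectrum_subset i := by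
    rw [← Unitization.quasispectrum_eq_spectrum_inr' ℝ ℂ]
    exact (hx i).2.2

lemma convex_saTuplesNonUnital (hK : ∀ i, (K i).OrdConnected) :
    Convex ℝ (saTuplesNonUnital B K) := by
  intro x hx y hy a b ha hb hab i
  refine ⟨add_mem ?_ ?_, ?_, ?_⟩
  · simpa using SMulMemClass.smul_mem (a : ℂ) (hx i).1
  · simpa using SMulMemClass.smul_mem (b : ℂ) (hy i).1
  · exact ((IsSelfAdjoint.all a).smul (hx i).2.1).add ((IsSelfAdjoint.all b).smul (hy i).2.1)
  · have hsx := (hx i).2.2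
    have hsy := (hy i).2.2
    rw [Unitization.quasispectrum_eq_spectrum_inr' ℝ ℂ] at hsx hsy ⊢
    rw [Pi.add_apply, Pi.smul_apply, Pi.smul_apply, Unitization.inr_add, Unitization.inr_smul,
      Unitization.inr_smul]
    exact spectrum_convexCombo_subset (Unitization.isSelfAdjoint_inr.2 (hx i).2.1)
      (Unitization.isSelfAdjoint_inr.2 (hy i).2.1) (hK i) hsx hsy ha hb hab

end Tuples

lemma extEllConvexOn_of_forall_eq_zero {E : Type*} [AddCommGroup E] [Module ℝ E] {e : ℝ → ℝ}
    {I : Set ℝ} {S : Set E} (hS : Convex ℝ S) (h0 : 0 ∈ e '' I) {F : E → ℝ≥0∞}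
    (hF : ∀ x, F x = 0) : ExtEllConvexOn e I S F := by
  obtain ⟨s, hs, hs0⟩ := h0
  have hS' : {x ∈ S | F x ≠ ∞} = S := by ext x; simp [hF]
  refine ⟨hS, fun _ => s, ?_, fun _ _ => hs, fun x _ => by simp [hF, hs0]⟩
  rw [hS']
  exact convexOn_const s hS

/-- The real linear embedding of tuples in `A` into tuples in the unitization. -/
noncomputable def inrTuple (A : Type*) [NonUnitalCStarAlgebra A] (n : ℕ) :
    (Fin n → A) →ₗ[ℝ] (Fin n → Unitization ℂ A) where
  toFun x i := Unitization.inr (x i)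
  map_add' x y := funext fun i => Unitization.inr_add ℂ (x i) (y i)
  map_smul' r x := funext fun i => Unitization.inr_smul ℂ r (x i)

theorem extEllConvexOn_traceExt {A : Type u} [NonUnitalCStarAlgebra A] [PartialOrder A]
    [StarOrderedRing A] {n : ℕ} {K : Fin n → Set ℝ} (hK : ∀ i, (K i).OrdConnected)
    {f : (Fin n → ℝ) → ℝ} (hf : ContinuousOn f (univ.pi K)) {e l : ℝ → ℝ} {I : Set ℝ}
    (hel : IsEllPair e l I) (hfl : EllConvexOn e I (univ.pi K) f)
    (hl : ConvexOn ℝ (interior (e '' I)) (ellQuot l)) (hhom : HomogeneousEllQuot l (e '' I))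
    (hf0 : ∀ p ∈ univ.pi K, 0 ≤ f p) {B : Fin n → NonUnitalStarSubalgebra ℂ A}
    (hB : MutuallyCommuting B) {τ : A → ℝ≥0∞} (hτ : IsDenseLscTrace τ)
    (hτ0 : 0 ∉ e '' I → ∃ a, 0 ≤ a ∧ τ a ≠ 0) :
    ExtEllConvexOn e I (saTuplesNonUnital B K)
      (fun x => traceExt τ (jointCfc f fun i => (x i : Unitization ℂ A))) := by
  have hT1 : 0 ∉ e '' I → traceExt τ 1 ≠ 0 := fun h0 => by
    obtain ⟨a, ha, haτ⟩ := hτ0 h0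
    exact hτ.traceExt_one_ne_zero ha haτ
  exact extEllConvexOn_of_isDominated (C := Unitization ℂ A) (T := traceExt τ) hK hf hel hfl hl hhom
    hf0 (fun y hy c hc => hτ.exists_isDominated_traceExt hy hc) hT1 (inrTuple A n)
    (convex_saTuplesNonUnital hK) fun x hx => isJointTuple_inr_of_mem hB hx

theorem theorem3 {n : ℕ} (K : Fin n → Set ℝ) (hK : ∀ i, (K i).OrdConnected)
    (f : (Fin n → ℝ) → ℝ) (hf : ContinuousOn f (Set.univ.pi K))
    (e l : ℝ → ℝ) (I : Set ℝ) (hel : IsEllPair e l I)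
    (hfl : EllConvexOn e I (Set.univ.pi K) f)
    (hl : ConvexOn ℝ (interior (e '' I)) (ellQuot l)) :
    -- tracial states (on unital algebras)
    (∀ (A : Type*) [CStarAlgebra A] [PartialOrder A] [StarOrderedRing A]
      (B : Fin n → NonUnitalStarSubalgebra ℂ A), (∀ i, IsClosed (B i : Set A)) →
      MutuallyCommuting B →
      ∀ τ : A →ₗ[ℂ] ℂ, IsTracialState τ →
        EllConvexOn e I (saTuples B K) (fun x => (τ (jointCfc f x)).re)) ∧
    (HomogeneousEllQuot l (e '' I) → (∀ p ∈ Set.univ.pi K, 0 ≤ f p) →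
      -- densely defined, lower semicontinuous traces on unital algebras
      (∀ (A : Type*) [CStarAlgebra A] [PartialOrder A] [StarOrderedRing A]
        (B : Fin n → NonUnitalStarSubalgebra ℂ A), (∀ i, IsClosed (B i : Set A)) →
        MutuallyCommuting B →
        ∀ τ : A → ℝ≥0∞, IsDenseLscTrace τ → (0 ∉ e '' I → ∃ a, 0 ≤ a ∧ τ a ≠ 0) →
          ExtEllConvexOn e I (saTuples B K) (fun x => τ (jointCfc f x))) ∧
      -- and on algebras without unit, where `f(x)` lies in the unitization
      (∀ (A : Type*) [NonUnitalCStarAlgebra A] [PartialOrder A] [StarOrderedRing A]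
        (B : Fin n → NonUnitalStarSubalgebra ℂ A), (∀ i, IsClosed (B i : Set A)) →
        MutuallyCommuting B →
        ∀ τ : A → ℝ≥0∞, IsDenseLscTrace τ → (0 ∉ e '' I → ∃ a, 0 ≤ a ∧ τ a ≠ 0) →
          ExtEllConvexOn e I (saTuplesNonUnital B K)
            (fun x => traceExt τ (jointCfc f fun i => (x i : Unitization ℂ A))))) := by
  refine ⟨fun A _ _ _ B _ hB τ hτ => ellConvexOn_tracialState hK hf hel hfl hl hB hτ,
    fun hhom hf0 => ⟨fun A _ _ _ B _ hB τ hτ hτ0 => ?_, fun A _ _ _ B _ hB τ hτ hτ0 => ?_⟩⟩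
  -- In the zero algebra spectra are empty and `τ = 0`; the assumption on `τ` then forces `0 ∈ e ''
  -- I`.
  · rcases subsingleton_or_nontrivial A with hA | hA
    · refine extEllConvexOn_of_forall_eq_zero (convex_saTuples hK) ?_ fun x => ?_
      · by_contra h0
        obtain ⟨a, -, ha⟩ := hτ0 h0
        exact ha (by rw [Subsingleton.elim a 0, hτ.map_zero])
      · rw [Subsingleton.elim (jointCfc f x) 0, hτ.map_zero]
    · refine extEllConvexOn_of_isDominated hK hf hel hfl hl hhom hf0
        (fun y hy c hc => hτ.exists_isDominated hy hc) (fun h0 h1 => ?_) LinearMap.id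
        (convex_saTuples hK) fun x hx => isJointTuple_of_mem_saTuples hB hx
      obtain ⟨a, ha, haτ⟩ := hτ0 h0
      have := hτ.le_norm_mul_apply_one ha
      rw [h1, mul_zero, nonpos_iff_eq_zero] at this
      exact haτ this
  · exact extEllConvexOn_traceExt hK hf hel hfl hl hhom hf0 hB hτ hτ0
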